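/- **Theorem (surgery is reverse connected sum).** Let $n\ge 2$. There are $\varepsilon_0>0$ and an integer $k_0\ge 1$, depending only on $n$, such that the following holds for all $\Lambda\ge 10$, $0<\varepsilon\le\varepsilon_0$, $k\ge k_0$, $0<\tau<1$, $B>10\Lambda$ and all codimensions $m$. Let $F:\mathcal M\to\mathbb R^{n+m}$ be a smooth immersion of a connected closed smooth $n$-manifold, let $N:\mathbb S^{n-1}\times[-4\Lambda,4\Lambda]\to\mathcal M$ be a normal $(\varepsilon,k)$-submanifold neck, and let the smooth immersion $\tilde F:\tilde{\mathcal M}\to\mathbb R^{n+m}$ of a closed smooth $n$-manifold result from $F$ by the standard surgery with parameters $\tau,B$ at the cross section $z=0$ of $N$. 1. If $\tilde{\mathcal M}$ is connected, then $\mathcal M$ is diffeomorphic to a connected sum of $\tilde{\mathcal M}$ with itself. 2. If $\tilde{\mathcal M}$ is disconnected, then it has exactly two components $\tilde{\mathcal M}_1,\tilde{\mathcal M}_2$, and $\mathcal M$ is diffeomorphic to a connected sum of $\tilde{\mathcal M}_1$ and $\tilde{\mathcal M}_2$. In particular, if $\tilde{\mathcal M}_2$ (either of the two components) is diffeomorphic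 to $\mathbb S^n$, then $\tilde{\mathcal M}_1$ (the other one) is diffeomorphic to $\mathcal M$. **Necks.** $N:\mathbb S^{n-1}\times[a,b]\to\mathcal M$ is a smooth embedding. Let $g$ be the metric induced by $F$, $\bar g$ the standard metric of the cylinder, $\Sigma_z=N(\mathbb S^{n-1}\times\{z\})$, $\sigma_{n-1}$ the area of the unit sphere, and $r(z)$ the mean radius, $|\Sigma_z|_g=\sigma_{n-1}r(z)^{n-1}$. Let $h=-(D^2F)^{\perp}$ be the second fundamental form (vector valued, with the sign for which it points outwards on round cylinders), $H=\operatorname{tr}_g h$, $|A|=|h|$, $\nu^+=H/|H|$. * $N$ is $(\varepsilon,k)$-*geometric* if $\hat g=r^{-2}g$ satisfies $|\hat g-\bar g|_{\bar g}\le\varepsilon$ and $|\bar D^j\hat g|_{\bar g}\le\varepsilon$ for $1\le j\le k$, and $|(d/dz)^j\log r|\le\varepsilon$ for $1\le j\le k$. * $N$ is a *submanifold neck* if moreover there is a unit normal field $\nu$ such that, for $h_\nu=\langle h,\nu\rangle$ with Weingarten map $W_\nu$ and $W_-=h-h_\nu\nu$, one has $|W_\nu-r^{-1}\bar W|\le\varepsilon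 r^{-1}$, $|W_-|\le\varepsilon r^{-1}$, and $|\nabla^l h|\le\varepsilon r^{-l-1}$ for $1\le l\le k$; here $\bar W$ is the identity in the sphere directions and $0$ in the axis direction, and norms are those of $g$. * $N$ is *normal* if each $\Sigma_z$ has constant mean curvature in $(\mathcal M,g)$; each $N|_{\mathbb S^{n-1}\times\{z\}}$, from the standard metric to the metric of $\Sigma_z$, is harmonic; $\operatorname{vol}_g(\mathbb S^{n-1}\times[v,w])=\sigma_{n-1}\int_v^w r^n\,dz$ for $a\le v\le w\le b$; and $\int_{\mathbb S^{n-1}\times\{z\}}\bar g(\bar V,U)\,d\bar\mu=0$ for each Killing field $\bar V$ of $\mathbb S^{n-1}\times\{z\}$, where $U$ is the unit normal of $\Sigma_z$ in $(\mathcal M,g)$ pointing to increasing $z$, and $\bar\mu$ is the standard measure. **Standard surgery at $z=0$.** Put $r_0=r(0)$. The approximating straight cylinder is $\bar C(\omega,z)=x_0+r_0(Q\omega+z e)$, where $x_0$ is the centre of mass of $\Sigma_0$, $e$ is the unit vector in the direction of the mean of $U$ over $\Sigma_0$ (both with respect to the induced measure), and $Q$ is a linear isometric embedding of $\mathbb R^n$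 into $e^\perp$ minimizing $\int_{\Sigma_0}|F\circ N(\omega,0)-x_0-r_0Q\omega|^2$ among all such embeddings. Let $\varphi:[0,4\Lambda]\to[0,1]$ be smooth and nonincreasing, $\varphi=1$ on $[0,2\Lambda]$, $\varphi=0$ on $[3\Lambda,4\Lambda]$. For each half of the neck put $z=s(\zeta-4\Lambda)$, $\zeta\in[0,4\Lambda]$, with $s=1$ for $z\le0$ and $s=-1$ for $z\ge0$. For each half choose $z_1\in(3\Lambda,4\Lambda]$ and a function $u$, smooth for $\zeta<z_1$, with $u=0$ for $\zeta\le\Lambda$, $u(\zeta)=r_0\exp(-B/(\zeta-\Lambda))$ for $\Lambda<\zeta\le3\Lambda$, $\tau u<r_0$ for $\zeta<z_1$ and $\tau u\to r_0$ as $\zeta\to z_1$, such that $\tilde C(\omega,\zeta)=\bar C(\omega,z)-\tau u(\zeta)Q\omega$ is uniformly spherically pinched on $[3\Lambda,z_1)$: $|A|^2-\frac1{n-1}|H|^2\le-\delta$ for some $\delta>0$. Put $$\hat N(\omega,\zeta)=\varphi(\zeta)\bigl(F\circ N(\omega,z)-\tau u(\zeta)\nu^+(\omega,z)\bigr)+(1-\varphi(\zeta))\,\tilde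 C(\omega,\zeta),\qquad 0<\zeta<z_1.$$ That $\tilde F:\tilde{\mathcal M}\to\mathbb R^{n+m}$ results from the surgery means: $\tilde{\mathcal M}$ is the union of a smoothly and openly embedded copy of $\mathcal M\setminus N(\mathbb S^{n-1}\times[-3\Lambda,3\Lambda])$, on which $\tilde F=F$, and of two disjoint smoothly and openly embedded open unit balls, one for each half of the neck. On each of them, in polar coordinates $x=t\omega$ and for a smooth function $\theta$ of $(0,1)$ onto $(0,z_1)$ with $\theta'<0$, one has $\tilde F(t\omega)=\hat N(\omega,\theta(t))$. The ball and the copy of $\mathcal M\setminus N(\mathbb S^{n-1}\times[-3\Lambda,3\Lambda])$ intersect exactly in the collar $0<\zeta<\Lambda$, where $t\omega$ is the point $N(\omega,z)$ with $\zeta=\theta(t)$. **Connected sums.** For smoothly embedded closed $n$-discs $i_1$ in $\mathcal M_1$ and $i_2$ in $\mathcal M_2$ (parametrized by the unit ball), the connected sum is obtained from the disjoint union of $\mathcal M_1\setminus i_1(0)$ and $\mathcal M_2\setminus i_2(0)$ by identifying $i_1(t\omega)$ with $i_2((1-t)\omega)$ for $0<t<1$, $|\omega|=1$. For two disjoint discs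 $i_1,i_2$ in one manifold $\tilde{\mathcal M}$, the same identification in $\tilde{\mathcal M}\setminus\{i_1(0),i_2(0)\}$ gives a connected sum of $\tilde{\mathcal M}$ with itself. No manifold is assumed to be orientable or oriented; "a connected sum" means one for some choice of the discs. -/

import Mathlib

open Set MeasureTheory
open scoped Manifold ContDiff

noncomputable section

namespace NeckSurgery

/-- Euclidean space `ℝⁿ`. -/
abbrev Euc (n : ℕ) := EuclideanSpace ℝ (Fin n)

/-- The Euclidean space `ℝⁿ × ℝ`, which contains the standard cylinder `S^{n-1} × ℝ`. -/
abbrev Cyl (n : ℕ) := WithLp 2 (Euc n × ℝ)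

/-- The point `(x, z)` of `ℝⁿ × ℝ`. -/
def pt {n : ℕ} (x : Euc n) (z : ℝ) : Cyl n := WithLp.toLp 2 (x, z)

/-- The set `(ℝⁿ ∖ 0) × I`, which retracts radially onto the cylinder `S^{n-1} × I`. -/
def tube (n : ℕ) (I : Set ℝ) : Set (Cyl n) := {p | p.fst ≠ 0 ∧ p.snd ∈ I}

/-- A map `f` on the cylinder `S^{n-1} × I` is written as a function `f ξ z`, of which only the
values at unit vectors `ξ` matter. Its extension to `(ℝⁿ ∖ 0) × I` is constant along rays; `f` is
smooth on the cylinder iff this extension is smooth, and the derivatives of the extension in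
directions tangent to the cylinder are those of `f`. -/
def radialExt {n : ℕ} {β : Type*} (f : Euc n → ℝ → β) : Cyl n → β :=
  fun p => f (‖p.fst‖⁻¹ • p.fst) p.snd

/-! ### Pointwise linear algebra

`L : D → V` is the differential of a parametrisation that is constant along the line spanned by
`ρ`, and is injective on the orthogonal complement of `ρ`. -/

section LinearAlgebra

variable {D V : Type*} [NormedAddCommGroup D] [InnerProductSpace ℝ D] [FiniteDimensional ℝ D]
  [NormedAddCommGroup V] [InnerProductSpace ℝ V] [FiniteDimensional ℝ V]

/-- The pulled back metric `⟪L v, L w⟫`, as an operator on `ρᗮ`, made invertible by adding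
`⟪ρ, v⟫ ⟪ρ, w⟫`. For a unit vector `ρ` this is the direct sum of the pulled back metric on `ρᗮ`
and of the identity of the line spanned by `ρ`. -/
def gramOp (L : D →L[ℝ] V) (ρ : D) : D →L[ℝ] D :=
  haveI : CompleteSpace D := FiniteDimensional.complete ℝ D
  haveI : CompleteSpace V := FiniteDimensional.complete ℝ V
  (ContinuousLinearMap.adjoint L).comp L + (innerSL ℝ ρ).smulRight ρ

/-- The vector `v ⟂ ρ` for which `L v` is the orthogonal projection of `y` to the range of `L`. -/
def pinv (L : D →L[ℝ] V) (ρ : D) : V →L[ℝ] D :=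
  haveI : CompleteSpace D := FiniteDimensional.complete ℝ D
  haveI : CompleteSpace V := FiniteDimensional.complete ℝ V
  (gramOp L ρ).inverse.comp (ContinuousLinearMap.adjoint L)

/-- The Riemannian density of the pulled back metric with respect to the Euclidean metric of `ρᗮ`
(for a unit vector `ρ`). -/
def jac (L : D →L[ℝ] V) (ρ : D) : ℝ := Real.sqrt (gramOp L ρ).det

end LinearAlgebra

/-! ### Geometry of a parametrised cylinder

`Y : (ℝⁿ ∖ 0) × I → V` is the radial extension of an immersion of `S^{n-1} × I` into a Euclidean
space `V`; `g` denotes the induced metric. -/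

section Geometry

variable {n : ℕ} {V : Type*} [NormedAddCommGroup V] [InnerProductSpace ℝ V]
  [FiniteDimensional ℝ V]

/-- The differential of `Y` (one sided at the ends of `I`). -/
def dMap (Y : Cyl n → V) (I : Set ℝ) (p : Cyl n) : Cyl n →L[ℝ] V :=
  fderivWithin ℝ Y (tube n I) p

/-- The second derivative `D²Y(v, w)`. -/
def d2Map (Y : Cyl n → V) (I : Set ℝ) (p v w : Cyl n) : V :=
  fderivWithin ℝ (fun q => dMap Y I q v) (tube n I) p w

/-- The vector tangent to the cylinder which `dY` maps to the tangential part of `y`. -/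
def lift (Y : Cyl n → V) (I : Set ℝ) (p : Cyl n) : V →L[ℝ] Cyl n :=
  pinv (dMap Y I p) (pt p.fst 0)

/-- The orthogonal projection of `V` to the tangent space of the immersion at `p`. -/
def tanProj (Y : Cyl n → V) (I : Set ℝ) (p : Cyl n) (y : V) : V := dMap Y I p (lift Y I p y)

/-- The orthogonal projection of `V` to the normal space of the immersion at `p`. -/
def norProj (Y : Cyl n → V) (I : Set ℝ) (p : Cyl n) (y : V) : V := y - tanProj Y I p y

/-- The vector valued second fundamental form `h`, with the sign `h = - (D²Y)^⊥` (so that it points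
outwards on a round cylinder), as a tensor on `V` through the tangential projection. -/
def sff (Y : Cyl n → V) (I : Set ℝ) (p : Cyl n) (y : Fin 2 → V) : V :=
  -norProj Y I p (d2Map Y I p (lift Y I p (y 0)) (lift Y I p (y 1)))

/-- The mean curvature vector `H = tr_g h`. -/
def meanCurv (Y : Cyl n → V) (I : Set ℝ) (p : Cyl n) : V :=
  ∑ a, sff Y I p (fun _ => stdOrthonormalBasis ℝ V a)

/-- The principal normal `ν⁺ = H / |H|`. -/
def principalNormal (Y : Cyl n → V) (I : Set ℝ) (p : Cyl n) : V :=
  ‖meanCurv Y I p‖⁻¹ • meanCurv Y I p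

/-- The squared norm of a tensor. A covariant tensor on the tangent space of the immersion
is evaluated on vectors of `V` through the tangential projection, so that the sum over an
orthonormal basis of `V` is its squared norm with respect to `g`. -/
def tensorNormSq {W : Type*} [NormedAddCommGroup W] {k : ℕ} (A : Cyl n → (Fin k → V) → W)
    (p : Cyl n) : ℝ :=
  ∑ i : Fin k → Fin (Module.finrank ℝ V), ‖A p (fun j => stdOrthonormalBasis ℝ V (i j))‖ ^ 2

/-- The covariant derivative of a tensor field along the immersion, with the Levi-Civita connection
of `g` in the arguments and the connection `Q ∘ d` in the values (`Q` is the normal projection for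
tensors with values in the normal bundle, the identity for scalar tensors). -/
def covDeriv {W : Type*} [NormedAddCommGroup W] [NormedSpace ℝ W] (Y : Cyl n → V) (I : Set ℝ)
    (Q : Cyl n → W → W) {k : ℕ} (A : Cyl n → (Fin k → V) → W) :
    Cyl n → (Fin (k + 1) → V) → W :=
  fun p y => Q p (fderivWithin ℝ (fun q => A q (fun i => tanProj Y I p (y i.succ)))
    (tube n I) p (lift Y I p (y 0)))

/-- The iterated covariant derivative `∇ˡ A`. -/
def iterCovDeriv {W : Type*} [NormedAddCommGroup W] [NormedSpace ℝ W] (Y : Cyl n → V) (I : Set ℝ)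
    (Q : Cyl n → W → W) {k : ℕ} (A : Cyl n → (Fin k → V) → W) :
    (l : ℕ) → Cyl n → (Fin (k + l) → V) → W
  | 0 => A
  | l + 1 => covDeriv Y I Q (iterCovDeriv Y I Q A l)

/-! #### Cross sections `Σ_z = Y(S^{n-1} × {z})` -/

/-- The differential of `Y(·, z)` at `x`. -/
def dSlice (Y : Cyl n → V) (z : ℝ) (x : Euc n) : Euc n →L[ℝ] V :=
  fderiv ℝ (fun x' => Y (pt x' z)) x

/-- The second derivative of `Y(·, z)` at `x`. -/
def d2Slice (Y : Cyl n → V) (z : ℝ) (x v w : Euc n) : V :=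
  fderiv ℝ (fun x' => dSlice Y z x' v) x w

/-- The standard surface measure of the unit sphere `S^{n-1}`. -/
def sphereMeasure (n : ℕ) : Measure (Metric.sphere (0 : Euc n) 1) :=
  (volume : Measure (Euc n)).toSphere

/-- The area `σ_{n-1}` of the unit sphere `S^{n-1}`. -/
def sphereArea (n : ℕ) : ℝ := (sphereMeasure n).real univ

/-- The area of the cross section `Σ_z` in the induced metric. -/
def sliceArea (Y : Cyl n → V) (z : ℝ) : ℝ :=
  ∫ ξ, jac (dSlice Y z (ξ : Euc n)) (ξ : Euc n) ∂(sphereMeasure n)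

/-- The mean radius `r(z)`, defined by `|Σ_z| = σ_{n-1} r(z)^{n-1}`. -/
def meanRadius (Y : Cyl n → V) (z : ℝ) : ℝ :=
  (sliceArea Y z / sphereArea n) ^ (((n : ℝ) - 1)⁻¹)

/-- The unit normal `U` of `Σ_z` in the immersed cylinder with its induced metric, in the direction
of increasing `z`, as a vector of `V`. -/
def sliceNormal (Y : Cyl n → V) (I : Set ℝ) (p : Cyl n) : V :=
  let L := dSlice Y p.snd p.fst
  let t := dMap Y I p (pt 0 1)
  let w := t - L (pinv L p.fst t)
  ‖w‖⁻¹ • w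

/-- The mean curvature of `Σ_z` in the immersed cylinder with its induced metric. -/
def sliceMeanCurv (Y : Cyl n → V) (I : Set ℝ) (p : Cyl n) : ℝ :=
  ∑ a, -inner ℝ
    (d2Slice Y p.snd p.fst
      (pinv (dSlice Y p.snd p.fst) p.fst (stdOrthonormalBasis ℝ V a))
      (pinv (dSlice Y p.snd p.fst) p.fst (stdOrthonormalBasis ℝ V a)))
    (sliceNormal Y I p)

/-! ### Necks -/

/-- The standard cylinder `S^{n-1} × ℝ ⊂ ℝⁿ × ℝ`, extended radially; its induced metric
is `ḡ`. -/
def stdCyl (n : ℕ) : Cyl n → Cyl n := radialExt pt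

/-- The difference `r(z)⁻² g - ḡ`, as a tensor on the standard cylinder. -/
def metricDefect (Y : Cyl n → V) (I : Set ℝ) (p : Cyl n) (y : Fin 2 → Cyl n) : ℝ :=
  (meanRadius Y p.snd ^ 2)⁻¹ *
      inner ℝ (dMap Y I p (lift (stdCyl n) I p (y 0))) (dMap Y I p (lift (stdCyl n) I p (y 1)))
    - inner ℝ (tanProj (stdCyl n) I p (y 0)) (tanProj (stdCyl n) I p (y 1))

/-- Intrinsic `(ε, k)`-geometric necks. Since `ḡ` is parallel for its own connection, the bound on
the derivatives of `ĝ = r⁻² g` is a bound on the derivatives of `ĝ - ḡ`. -/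
structure IsGeometricNeck (Y : Cyl n → V) (a b ε : ℝ) (k : ℕ) : Prop where
  metric_close : ∀ j ≤ k, ∀ ξ : Euc n, ‖ξ‖ = 1 → ∀ z ∈ Icc a b,
    tensorNormSq (iterCovDeriv (stdCyl n) (Icc a b) (fun _ w => w)
      (metricDefect Y (Icc a b)) j) (pt ξ z) ≤ ε ^ 2
  radius_close : ∀ j : ℕ, 1 ≤ j → j ≤ k → ∀ z ∈ Icc a b,
    |iteratedDerivWithin j (fun z' => Real.log (meanRadius Y z')) (Icc a b) z| ≤ ε

/-- Normal necks. -/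
structure IsNormalNeck (Y : Cyl n → V) (a b : ℝ) : Prop where
  /-- Each cross section has constant mean curvature. -/
  constant_mean_curvature : ∀ z ∈ Icc a b, ∃ c : ℝ, ∀ ξ : Euc n, ‖ξ‖ = 1 →
    sliceMeanCurv Y (Icc a b) (pt ξ z) = c
  /-- `S^{n-1} → Σ_z` is harmonic: the part of the spherical Laplacian of `Y(·, z)` that
  is tangent to `Σ_z` vanishes. -/
  harmonic : ∀ z ∈ Icc a b, ∀ ξ : Euc n, ‖ξ‖ = 1 → ∀ v : Euc n,
    inner ℝ (∑ i, d2Slice Y z ξ (EuclideanSpace.basisFun (Fin n) ℝ i)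
      (EuclideanSpace.basisFun (Fin n) ℝ i)) (dSlice Y z ξ v) = 0
  /-- The volume of each subcylinder is `σ_{n-1} ∫ r(z)ⁿ dz`. -/
  volume_eq : ∀ v ∈ Icc a b, ∀ w ∈ Icc a b, v ≤ w →
    ∫ z in v..w, ∫ ξ, jac (dMap Y (Icc a b) (pt (ξ : Euc n) z)) (pt (ξ : Euc n) 0)
        ∂(sphereMeasure n)
      = sphereArea n * ∫ z in v..w, meanRadius Y z ^ n
  /-- The unit normal `U` of the cross sections is orthogonal, with respect to the standard metric
  and measure, to the Killing fields `ξ ↦ K ξ` (`K` skew symmetric) of the sphere. -/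
  killing : ∀ z ∈ Icc a b, ∀ K : Euc n →L[ℝ] Euc n, (∀ x, inner ℝ (K x) x = 0) →
    ∫ ξ, inner ℝ (K (ξ : Euc n)) (lift Y (Icc a b) (pt (ξ : Euc n) z)
        (sliceNormal Y (Icc a b) (pt (ξ : Euc n) z))).fst ∂(sphereMeasure n) = 0

/-- The component `W_ν - r⁻¹ W̄` as a bilinear form, where `W̄` is the Weingarten map of the standard
cylinder: the identity in the directions of the sphere, zero in the direction of the axis. -/
def weingartenDefect (Y : Cyl n → V) (I : Set ℝ) (ν : Euc n → ℝ → V) (p : Cyl n)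
    (y : Fin 2 → V) : ℝ :=
  inner ℝ (sff Y I p y) (ν p.fst p.snd) -
    (meanRadius Y p.snd)⁻¹ * inner ℝ (dMap Y I p (pt (lift Y I p (y 0)).fst 0)) (y 1)

/-- The part `W_-` of the second fundamental form in the normal directions orthogonal to `ν`. -/
def sffMinus (Y : Cyl n → V) (I : Set ℝ) (ν : Euc n → ℝ → V) (p : Cyl n) (y : Fin 2 → V) : V :=
  sff Y I p y - (inner ℝ (sff Y I p y) (ν p.fst p.snd) : ℝ) • ν p.fst p.snd

/-- `(ε, k)`-cylindrical submanifold necks. -/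
structure IsSubmanifoldNeck (Y : Cyl n → V) (a b ε : ℝ) (k : ℕ) : Prop where
  geometric : IsGeometricNeck Y a b ε k
  extrinsic : ∃ ν : Euc n → ℝ → V, ∀ ξ : Euc n, ‖ξ‖ = 1 → ∀ z ∈ Icc a b,
    ‖ν ξ z‖ = 1 ∧ (∀ v, inner ℝ (ν ξ z) (dMap Y (Icc a b) (pt ξ z) v) = 0) ∧
    tensorNormSq (weingartenDefect Y (Icc a b) ν) (pt ξ z) ≤ (ε * (meanRadius Y z)⁻¹) ^ 2 ∧
    tensorNormSq (sffMinus Y (Icc a b) ν) (pt ξ z) ≤ (ε * (meanRadius Y z)⁻¹) ^ 2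
  derivatives : ∀ l : ℕ, 1 ≤ l → l ≤ k → ∀ ξ : Euc n, ‖ξ‖ = 1 → ∀ z ∈ Icc a b,
    tensorNormSq (iterCovDeriv Y (Icc a b) (norProj Y (Icc a b)) (sff Y (Icc a b)) l) (pt ξ z)
      ≤ (ε * ((meanRadius Y z)⁻¹) ^ (l + 1)) ^ 2

/-! ### The approximating straight cylinder at the cross section `z = 0` -/

/-- The mean over `Σ_0`, with its induced metric, of a vector field along `Σ_0`. -/
def sliceMean (Y : Cyl n → V) (f : Euc n → V) : V :=
  (sliceArea Y 0)⁻¹ •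
    ∫ ξ, jac (dSlice Y 0 (ξ : Euc n)) (ξ : Euc n) • f (ξ : Euc n) ∂(sphereMeasure n)

/-- The centre of mass of `Σ_0`: a point of the axis. -/
def centre (Y : Cyl n → V) : V := sliceMean Y (fun ξ => Y (pt ξ 0))

/-- The unit vector in the direction of the mean of the unit normal of `Σ_0`: the direction of the
axis. -/
def axisDir (Y : Cyl n → V) (I : Set ℝ) : V :=
  ‖sliceMean Y (fun ξ => sliceNormal Y I (pt ξ 0))‖⁻¹ •
    sliceMean Y (fun ξ => sliceNormal Y I (pt ξ 0))

/-- The squared `L²`-distance between `Σ_0` and the cross section of the straight cylinder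
with frame `Q`. -/
def frameError (Y : Cyl n → V) (Q : Euc n →ₗᵢ[ℝ] V) : ℝ :=
  ∫ ξ, jac (dSlice Y 0 (ξ : Euc n)) (ξ : Euc n) *
    ‖Y (pt (ξ : Euc n) 0) - (centre Y + meanRadius Y 0 • Q (ξ : Euc n))‖ ^ 2 ∂(sphereMeasure n)

/-- `(ξ, z) ↦ centre + r(0) (Q ξ + z axis)` is a straight cylinder with the prescribed
radius and axis that best approximates the neck at `Σ_0`. -/
def IsBestFrame (Y : Cyl n → V) (I : Set ℝ) (Q : Euc n →ₗᵢ[ℝ] V) : Prop :=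
  (∀ x, inner ℝ (Q x) (axisDir Y I) = 0) ∧
  ∀ Q' : Euc n →ₗᵢ[ℝ] V, (∀ x, inner ℝ (Q' x) (axisDir Y I) = 0) →
    frameError Y Q ≤ frameError Y Q'

/-! ### The standard surgery at `z = 0` on a neck over `[-4Λ, 4Λ]`

The two halves of the neck are treated alike, with the coordinate `ζ ∈ [0, 4Λ]` that
increases towards the cross section `Σ_0`: `z = s (ζ - 4Λ)`, where `s = 1` for the half over
`[-4Λ, 0]` and `s = -1` for the half over `[0, 4Λ]`. -/

/-- The transition function: smooth and decreasing on `[0, 4Λ]`, one on `[0, 2Λ]` and zero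
on `[3Λ, 4Λ]`. -/
structure IsTransition (Λ : ℝ) (φ : ℝ → ℝ) : Prop where
  smooth : ContDiffOn ℝ ∞ φ (Icc 0 (4 * Λ))
  antitone : AntitoneOn φ (Icc 0 (4 * Λ))
  eq_one : ∀ ζ ∈ Icc 0 (2 * Λ), φ ζ = 1
  eq_zero : ∀ ζ ∈ Icc (3 * Λ) (4 * Λ), φ ζ = 0

/-- The straight cylinder bent inwards by `τ u`. -/
def bentCylinder (Y : Cyl n → V) (Λ τ : ℝ) (Q : Euc n →ₗᵢ[ℝ] V) (s : ℝ) (u : ℝ → ℝ)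
    (ξ : Euc n) (ζ : ℝ) : V :=
  centre Y + (meanRadius Y 0 - τ * u ζ) • Q ξ +
    (meanRadius Y 0 * (s * (ζ - 4 * Λ))) • axisDir Y (Icc (-(4 * Λ)) (4 * Λ))

/-- The neck bent inwards by `τ u` in the direction of its principal normal. -/
def bentNeck (Y : Cyl n → V) (Λ τ s : ℝ) (u : ℝ → ℝ) (ξ : Euc n) (ζ : ℝ) : V :=
  Y (pt ξ (s * (ζ - 4 * Λ))) -
    (τ * u ζ) • principalNormal Y (Icc (-(4 * Λ)) (4 * Λ)) (pt ξ (s * (ζ - 4 * Λ)))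

/-- The surgically modified half neck: interpolation between the bent neck and
the bent cylinder. -/
def modifiedNeck (Y : Cyl n → V) (Λ τ : ℝ) (φ : ℝ → ℝ) (Q : Euc n →ₗᵢ[ℝ] V) (s : ℝ) (u : ℝ → ℝ)
    (ξ : Euc n) (ζ : ℝ) : V :=
  φ ζ • bentNeck Y Λ τ s u ξ ζ + (1 - φ ζ) • bentCylinder Y Λ τ Q s u ξ ζ

/-- The bending function `u`: it is `r(0) exp(-B / (ζ - Λ))` for `Λ < ζ ≤ 3Λ`, extended by zero
to `ζ ≤ Λ`; beyond `3Λ` it is continued smoothly so that the bent cylinder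
closes up to a uniformly spherically pinched axially symmetric cap, whose tip is reached at
`ζ = z₁ ∈ (3Λ, 4Λ]`. -/
structure IsCapProfile (Y : Cyl n → V) (Λ τ B : ℝ) (Q : Euc n →ₗᵢ[ℝ] V) (s : ℝ)
    (u : ℝ → ℝ) (z₁ : ℝ) : Prop where
  mem : z₁ ∈ Ioc (3 * Λ) (4 * Λ)
  smooth : ContDiffOn ℝ ∞ u (Iio z₁)
  eq_zero : ∀ ζ ≤ Λ, u ζ = 0
  eq_exp : ∀ ζ ∈ Ioc Λ (3 * Λ), u ζ = meanRadius Y 0 * Real.exp (-(B / (ζ - Λ)))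
  radius_pos : ∀ ζ < z₁, τ * u ζ < meanRadius Y 0
  closes : Filter.Tendsto (fun ζ => τ * u ζ) (nhdsWithin z₁ (Iio z₁)) (nhds (meanRadius Y 0))
  pinched : ∃ δ > 0, ∀ ξ : Euc n, ‖ξ‖ = 1 → ∀ ζ ∈ Ico (3 * Λ) z₁,
    tensorNormSq (sff (radialExt (bentCylinder Y Λ τ Q s u)) (Ico (3 * Λ) z₁)) (pt ξ ζ) -
      ((n : ℝ) - 1)⁻¹ *
        ‖meanCurv (radialExt (bentCylinder Y Λ τ Q s u)) (Ico (3 * Λ) z₁) (pt ξ ζ)‖ ^ 2 ≤ -δ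

/-! ### Manifolds -/

/-- Smooth immersions of `n`-manifolds into a Euclidean space. -/
def IsSmoothImmersion {n d : ℕ} {M : Type*} [TopologicalSpace M] [ChartedSpace (Euc n) M]
    (F : M → Euc d) : Prop :=
  ContMDiff (𝓡 n) (𝓡 d) ∞ F ∧ ∀ x, Function.Injective (mfderiv (𝓡 n) (𝓡 d) F x)

/-- A topological neck: a smooth embedding of the cylinder `S^{n-1} × [a, b]` in the `n`-manifold
`M`. The differential of the radial extension of `N` vanishes on the radial direction, so that its
surjectivity means that the differential of `N` is an isomorphism. -/
structure IsTopologicalNeck {n : ℕ} {M : Type*} [TopologicalSpace M] [ChartedSpace (Euc n) M]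
    (N : Euc n → ℝ → M) (a b : ℝ) : Prop where
  smooth : ContMDiffOn 𝓘(ℝ, Cyl n) (𝓡 n) ∞ (radialExt N) (tube n (Icc a b))
  submersive : ∀ p ∈ tube n (Icc a b), Function.Surjective
    (mfderivWithin 𝓘(ℝ, Cyl n) (𝓡 n) (radialExt N) (tube n (Icc a b)) p)
  injective : ∀ ξ ξ' : Euc n, ‖ξ‖ = 1 → ‖ξ'‖ = 1 → ∀ z ∈ Icc a b, ∀ z' ∈ Icc a b,
    N ξ z = N ξ' z' → ξ = ξ' ∧ z = z'

/-- The parametrisation `F ∘ N` of the neck in Euclidean space, extended radially. -/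
def neckMap {n d : ℕ} {M : Type*} (F : M → Euc d) (N : Euc n → ℝ → M) : Cyl n → Euc d :=
  radialExt (fun ξ z => F (N ξ z))

/-- A normal `(ε, k)`-submanifold neck `N : S^{n-1} × [a, b] → M` of the immersion `F`. -/
structure IsNormalSubmanifoldNeck {n d : ℕ} {M : Type*} [TopologicalSpace M]
    [ChartedSpace (Euc n) M] (F : M → Euc d) (N : Euc n → ℝ → M) (a b ε : ℝ) (k : ℕ) : Prop where
  topological : IsTopologicalNeck N a b
  normal : IsNormalNeck (neckMap F N) a b
  submanifold : IsSubmanifoldNeck (neckMap F N) a b ε k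

/-- The part `N(S^{n-1} × [-3Λ, 3Λ])` of `M` which is replaced by the surgery. -/
def core {n : ℕ} {M : Type*} (N : Euc n → ℝ → M) (Λ : ℝ) : Set M :=
  {x | ∃ ξ : Euc n, ‖ξ‖ = 1 ∧ ∃ z ∈ Icc (-(3 * Λ)) (3 * Λ), x = N ξ z}

/-- `c : {x ∈ ℝⁿ | |x| < 1} → M'` is the ball which is attached to the half of the neck with sign
`s` in the surgery, and which consists of the collar `0 < ζ < Λ`, where it is attached
to the unchanged part `j : M ∖ core → M'`, and of the cap. In polar coordinates `x = t ξ`, where the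
radius `t ∈ (0, 1)` is a smooth decreasing function of `ζ ∈ (0, z₁)`, the new immersion `F'` is the
modified neck. -/
def IsAttachedCap {n d : ℕ} {M M' : Type*} [TopologicalSpace M'] [ChartedSpace (Euc n) M']
    (F : M → Euc d) (N : Euc n → ℝ → M) (Λ τ B : ℝ) (φ : ℝ → ℝ) (Q : Euc n →ₗᵢ[ℝ] Euc d)
    (F' : M' → Euc d) (j : M → M') (s : ℝ) (c : Euc n → M') : Prop :=
  ∃ (u θ : ℝ → ℝ) (z₁ : ℝ),
    IsCapProfile (neckMap F N) Λ τ B Q s u z₁ ∧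
    ContDiffOn ℝ ∞ θ (Ioo 0 1) ∧ (∀ t ∈ Ioo (0 : ℝ) 1, deriv θ t < 0) ∧
    θ '' Ioo 0 1 = Ioo 0 z₁ ∧
    IsLocalDiffeomorphOn (𝓡 n) (𝓡 n) ∞ c (Metric.ball 0 1) ∧ InjOn c (Metric.ball 0 1) ∧
    (∀ ξ : Euc n, ‖ξ‖ = 1 → ∀ t ∈ Ioo (0 : ℝ) 1,
      F' (c (t • ξ)) = modifiedNeck (neckMap F N) Λ τ φ Q s u ξ (θ t)) ∧
    (∀ ξ : Euc n, ‖ξ‖ = 1 → ∀ t ∈ Ioo (0 : ℝ) 1, θ t < Λ →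
      c (t • ξ) = j (N ξ (s * (θ t - 4 * Λ)))) ∧
    (∀ x ∉ core N Λ, j x ∈ c '' Metric.ball 0 1 →
      ∃ ξ : Euc n, ‖ξ‖ = 1 ∧ ∃ ζ ∈ Ioo 0 Λ, x = N ξ (s * (ζ - 4 * Λ)))

/-- The immersed manifold `F' : M' → ℝᵈ` results from the immersed manifold `F : M → ℝᵈ` by the
standard surgery with parameters `τ, B` at the cross section `z = 0` of the neck
`N : S^{n-1} × [-4Λ, 4Λ] → M`: the complement of `N(S^{n-1} × [-3Λ, 3Λ])` is unchanged, and a ball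
is attached to each of its two collars. -/
def IsStandardSurgery {n d : ℕ} {M M' : Type*} [TopologicalSpace M] [ChartedSpace (Euc n) M]
    [TopologicalSpace M'] [ChartedSpace (Euc n) M'] (F : M → Euc d) (N : Euc n → ℝ → M)
    (Λ τ B : ℝ) (F' : M' → Euc d) : Prop :=
  ∃ (φ : ℝ → ℝ) (Q : Euc n →ₗᵢ[ℝ] Euc d) (j : M → M') (c₁ c₂ : Euc n → M'),
    IsTransition Λ φ ∧
    IsBestFrame (neckMap F N) (Icc (-(4 * Λ)) (4 * Λ)) Q ∧
    IsLocalDiffeomorphOn (𝓡 n) (𝓡 n) ∞ j (core N Λ)ᶜ ∧ InjOn j (core N Λ)ᶜ ∧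
    (∀ x ∉ core N Λ, F' (j x) = F x) ∧
    IsAttachedCap F N Λ τ B φ Q F' j 1 c₁ ∧
    IsAttachedCap F N Λ τ B φ Q F' j (-1) c₂ ∧
    Disjoint (c₁ '' Metric.ball 0 1) (c₂ '' Metric.ball 0 1) ∧
    j '' (core N Λ)ᶜ ∪ c₁ '' Metric.ball 0 1 ∪ c₂ '' Metric.ball 0 1 = univ

/-- `x₁` and `x₂` are identified in the connected sum along the discs `i₁` and `i₂`:
`x₁ = i₁ (t ξ)` and `x₂ = i₂ ((1 - t) ξ)` with `|ξ| = 1` and `0 < t < 1`. -/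
def Glued {n : ℕ} {M₁ M₂ : Type*} (i₁ : Euc n → M₁) (i₂ : Euc n → M₂) (x₁ : M₁) (x₂ : M₂) : Prop :=
  ∃ ξ : Euc n, ‖ξ‖ = 1 ∧ ∃ t ∈ Ioo (0 : ℝ) 1, x₁ = i₁ (t • ξ) ∧ x₂ = i₂ ((1 - t) • ξ)

/-- A smoothly embedded disc of full dimension: the restriction to the closed unit ball of a smooth
open embedding of `ℝⁿ`. -/
def IsDisc {n : ℕ} {M : Type*} [TopologicalSpace M] [ChartedSpace (Euc n) M]
    (i : Euc n → M) : Prop :=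
  IsLocalDiffeomorph (𝓡 n) (𝓡 n) ∞ i ∧ Function.Injective i

/-- `M` is diffeomorphic to a connected sum of `M₁` and `M₂`: for embedded discs `i₁`, `i₂`,
it is the smooth manifold obtained from the disjoint union of `M₁ ∖ i₁(0)` and `M₂ ∖ i₂(0)` by
identifying `i₁ (t ξ)` with `i₂ ((1 - t) ξ)`. The maps `f₁`, `f₂` are the inclusions of the
two open pieces. -/
def IsConnectedSum (n : ℕ) (M₁ M₂ M : Type*)
    [TopologicalSpace M₁] [ChartedSpace (Euc n) M₁] [TopologicalSpace M₂] [ChartedSpace (Euc n) M₂]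
    [TopologicalSpace M] [ChartedSpace (Euc n) M] : Prop :=
  ∃ (i₁ : Euc n → M₁) (i₂ : Euc n → M₂) (f₁ : M₁ → M) (f₂ : M₂ → M),
    IsDisc i₁ ∧ IsDisc i₂ ∧
    IsLocalDiffeomorphOn (𝓡 n) (𝓡 n) ∞ f₁ {i₁ 0}ᶜ ∧ InjOn f₁ {i₁ 0}ᶜ ∧
    IsLocalDiffeomorphOn (𝓡 n) (𝓡 n) ∞ f₂ {i₂ 0}ᶜ ∧ InjOn f₂ {i₂ 0}ᶜ ∧
    f₁ '' {i₁ 0}ᶜ ∪ f₂ '' {i₂ 0}ᶜ = univ ∧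
    ∀ x₁ ∈ ({i₁ 0}ᶜ : Set M₁), ∀ x₂ ∈ ({i₂ 0}ᶜ : Set M₂), f₁ x₁ = f₂ x₂ ↔ Glued i₁ i₂ x₁ x₂

/-- `M` is diffeomorphic to a connected sum of `M'` with itself: for disjoint embedded discs `i₁`,
`i₂` in `M'`, it is the smooth manifold obtained from `M' ∖ {i₁(0), i₂(0)}` by identifying
`i₁ (t ξ)` with `i₂ ((1 - t) ξ)`. The map `f` is the quotient map. -/
def IsSelfConnectedSum (n : ℕ) (M' M : Type*)
    [TopologicalSpace M'] [ChartedSpace (Euc n) M'] [TopologicalSpace M] [ChartedSpace (Euc n) M] :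
    Prop :=
  ∃ (i₁ i₂ : Euc n → M') (f : M' → M),
    IsDisc i₁ ∧ IsDisc i₂ ∧
    Disjoint (i₁ '' Metric.closedBall 0 1) (i₂ '' Metric.closedBall 0 1) ∧
    IsLocalDiffeomorphOn (𝓡 n) (𝓡 n) ∞ f {i₁ 0, i₂ 0}ᶜ ∧
    f '' {i₁ 0, i₂ 0}ᶜ = univ ∧
    ∀ x ∈ ({i₁ 0, i₂ 0}ᶜ : Set M'), ∀ y ∈ ({i₁ 0, i₂ 0}ᶜ : Set M'),
      f x = f y ↔ x = y ∨ Glued i₁ i₂ x y ∨ Glued i₁ i₂ y x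

end Geometry

end NeckSurgery

end

/-! The argument is differential-topological. After surgery, the manifold `M'` consists of `M` minus
the core of the neck and two open balls. Send each punctured ball back into the neck by t ω ↦ N(ω, s
G(t)), where G is a decreasing function of the radius. Far out, G is the attaching coordinate θ(t) -
4Λ; for t ≤ 2 it is K(1/2 - t), so it runs past the cross section z = 0 up to K/2
(`exists_profile`). The two images then cover the neck and overlap exactly in |z| < K/2. There K(1/2
- t) = -K(1/2 - t') holds iff t' = 1 - t, which is the identification in a connected sum
(`glued_of_polarNeck_eq`). Together with the inverse of the inclusion `j` of the unchanged part,
these maps form a surjective local diffeomorphism f from `M'` minus two points to `M` whose only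
identifications are those of the connected sum (`exists_isSelfGluing`).

If `M'` is connected, this is the first claim. In general, a nonempty clopen set disjoint from both
discs would have a clopen image in the connected manifold `M`, hence the whole of `M` as image,
although the punctured discs have images that it cannot reach. So every nonempty clopen set contains
a disc (`IsSelfGluing.range_subset_of_isClopen`). A disconnected `M'` therefore has two components
with one disc in each, and restricting f to them exhibits `M` as their connected sum.

For a sphere summand, it suffices to parametrise the sphere minus the centre of the disc i by the
open unit ball, so that x ↦ i((1 - |x|)/|x| · x) near the boundary (`exists_complementary_ball`);
this ball then fills the disc removed from the other summand. Only the germ of i at its centre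
matters. Stereographic projection turns the problem into one about a germ κ at 0 in ℝⁿ seen through
inversions. Let A be the differential of κ. The germ κ ∘ A⁻¹ is tangent to the identity, so a cutoff
extends it to a diffeomorphism equal to the identity far out (`exists_extension_of_germ`), whose
conjugate by the inversion is smooth at 0. The linear part A is absorbed by a map that preserves
rays (`exists_radial_diffeo`), which requires neither a path from A to an isometry nor a choice of
orientation. -/

namespace NeckSurgery

/-! ### Local diffeomorphisms and the inverse function theorem -/

section LocalDiffeomorphisms

open Filter Topology

variable {E F G : Type*} [NormedAddCommGroup E] [NormedSpace ℝ E] [NormedAddCommGroup F]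
  [NormedSpace ℝ F] [NormedAddCommGroup G] [NormedSpace ℝ G]
  {H₁ H₂ H₃ : Type*} [TopologicalSpace H₁] [TopologicalSpace H₂] [TopologicalSpace H₃]
  {I : ModelWithCorners ℝ E H₁} {J : ModelWithCorners ℝ F H₂} {K : ModelWithCorners ℝ G H₃}
  {M N P : Type*} [TopologicalSpace M] [ChartedSpace H₁ M] [TopologicalSpace N]
  [ChartedSpace H₂ N] [TopologicalSpace P] [ChartedSpace H₃ P] {k : WithTop ℕ∞}

theorem isLocalDiffeomorphAt_congr {f g : M → N} {x : M} (hf : IsLocalDiffeomorphAt I J k f x)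
    (h : g =ᶠ[𝓝 x] f) : IsLocalDiffeomorphAt I J k g x := by
  obtain ⟨Φ, hx, heq⟩ := hf
  obtain ⟨U, hU, hUo, hxU⟩ := mem_nhds_iff.mp h
  refine ⟨{ (Φ.toOpenPartialHomeomorph.restrOpen U hUo) with
      contMDiffOn_toFun := Φ.contMDiffOn_toFun.mono ?_
      contMDiffOn_invFun := Φ.contMDiffOn_invFun.mono ?_ }, ?_, ?_⟩
  · exact inter_subset_left
  · exact inter_subset_left
  · exact ⟨hx, hxU⟩
  · intro y hy
    rw [show g y = f y from hU hy.2]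
    exact heq hy.1

/-- If `i` and `g ∘ i` are local diffeomorphisms, then so is `g`. -/
theorem isLocalDiffeomorphAt_of_comp_right {i : M → N} {g : N → P} {h : M → P} {x : M}
    (hh : IsLocalDiffeomorphAt I K k h x) (hi : IsLocalDiffeomorphAt I J k i x)
    (hg : g ∘ i =ᶠ[𝓝 x] h) : IsLocalDiffeomorphAt J K k g (i x) := by
  have hx : hi.localInverse (i x) = x := hi.localInverse_left_inv hi.localInverse_mem_target
  have h0 : IsLocalDiffeomorphAt I K k h (hi.localInverse (i x)) := by rwa [hx]
  have h1 : IsLocalDiffeomorphAt J K k (h ∘ hi.localInverse) (i x) :=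
    hi.localInverse_isLocalDiffeomorphAt.comp K P h0
  refine isLocalDiffeomorphAt_congr h1 ?_
  have hc : Tendsto hi.localInverse (𝓝 (i x)) (𝓝 x) := by
    have := hi.localInverse_contMDiffAt.continuousAt
    rwa [ContinuousAt, hx] at this
  filter_upwards [hc.eventually hg, hi.localInverse_eventuallyEq_right] with y hy hy'
  rw [Function.comp_apply, ← hy, Function.comp_apply]
  exact congrArg g hy'.symm

/-- If `i` and `i ∘ g` are local diffeomorphisms, then so is `g`. -/
theorem isLocalDiffeomorphAt_of_comp_left {i : N → P} {g : M → N} {h : M → P} {x : M}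
    (hh : IsLocalDiffeomorphAt I K k h x) (hi : IsLocalDiffeomorphAt J K k i (g x))
    (hgc : ContinuousAt g x) (hg : i ∘ g =ᶠ[𝓝 x] h) : IsLocalDiffeomorphAt I J k g x := by
  have hx : h x = i (g x) := hg.self_of_nhds.symm
  have h0 : IsLocalDiffeomorphAt K J k hi.localInverse (h x) := by
    rw [hx]; exact hi.localInverse_isLocalDiffeomorphAt
  have h1 : IsLocalDiffeomorphAt I J k (hi.localInverse ∘ h) x := hh.comp J N h0
  refine isLocalDiffeomorphAt_congr h1 ?_
  filter_upwards [hg, hgc.eventually hi.localInverse_eventuallyEq_left] with y hy hy'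
  rw [Function.comp_apply, ← hy, Function.comp_apply]
  exact hy'.symm

/-- A local diffeomorphism maps neighbourhoods to neighbourhoods. -/
theorem map_nhds_of_isLocalDiffeomorphAt {f : M → N} {x : M}
    (hf : IsLocalDiffeomorphAt I J k f x) : map f (𝓝 x) = 𝓝 (f x) := by
  obtain ⟨Φ, hx, heq⟩ := hf
  rw [heq hx]
  have h2 := Φ.toOpenPartialHomeomorph.map_nhds_eq hx
  rw [← show map Φ.toOpenPartialHomeomorph (𝓝 x) = 𝓝 (Φ x) from h2]
  exact map_congr (eventuallyEq_of_mem (Φ.open_source.mem_nhds hx) heq)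

theorem isOpen_image_of_isLocalDiffeomorphOn {f : M → N} {s : Set M}
    (hf : IsLocalDiffeomorphOn I J k f s) {U : Set M} (hU : IsOpen U) (hUs : U ⊆ s) :
    IsOpen (f '' U) := by
  rw [isOpen_iff_mem_nhds]
  rintro _ ⟨x, hx, rfl⟩
  rw [← map_nhds_of_isLocalDiffeomorphAt (hf ⟨x, hUs hx⟩)]
  exact image_mem_map (hU.mem_nhds hx)

/-- The inverse function theorem for smooth maps. -/
theorem isLocalDiffeomorphAt_of_hasFDerivAt [CompleteSpace E] {f : E → F} {U : Set E}
    (hU : IsOpen U) (hf : ContDiffOn ℝ ∞ f U) {a : E} (ha : a ∈ U) (f' : E ≃L[ℝ] F)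
    (hf' : HasFDerivAt f (f' : E →L[ℝ] F) a) :
    IsLocalDiffeomorphAt 𝓘(ℝ, E) 𝓘(ℝ, F) ∞ f a := by
  have hfa : ContDiffAt ℝ ∞ f a := hf.contDiffAt (hU.mem_nhds ha)
  let e := hfa.toOpenPartialHomeomorph f hf' (by simp)
  have he : (e : E → F) = f := rfl
  -- The inverse must be smooth on its whole domain, so the source is cut down to the points with
  -- invertible differential; these form an open set because the invertible operators do.
  have hopen : IsOpen {y | y ∈ U ∧ fderiv ℝ f y ∈ range ((↑) : (E ≃L[ℝ] F) → E →L[ℝ] F)} := by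
    rw [isOpen_iff_mem_nhds]
    rintro y ⟨hy, hy'⟩
    have hc : ContinuousOn (fderiv ℝ f) U := hf.continuousOn_fderiv_of_isOpen hU (by simp)
    have h1 := (hc.continuousAt (hU.mem_nhds hy)).preimage_mem_nhds
      (ContinuousLinearEquiv.isOpen.mem_nhds hy')
    filter_upwards [h1, hU.mem_nhds hy] with z hz hz'
    exact ⟨hz', hz⟩
  set V := {y | y ∈ U ∧ fderiv ℝ f y ∈ range ((↑) : (E ≃L[ℝ] F) → E →L[ℝ] F)}
  let e' := e.restrOpen V hopen
  have hsm : ∀ y ∈ e'.source, y ∈ e.source ∧ y ∈ V := fun y hy => hy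
  refine ⟨{ e' with
      contMDiffOn_toFun := ?_
      contMDiffOn_invFun := ?_ }, ?_, ?_⟩
  · exact (hf.mono fun y hy => (hsm y hy).2.1).contMDiffOn
  · refine ContDiffOn.contMDiffOn fun y hy => ContDiffAt.contDiffWithinAt ?_
    have hs := hsm _ (e'.map_target hy)
    obtain ⟨L, hL⟩ := hs.2.2
    have hd : ContDiffAt ℝ ∞ f (e'.symm y) := hf.contDiffAt (hU.mem_nhds hs.2.1)
    refine e'.contDiffAt_symm (f₀' := L) hy ?_ hd
    rw [hL]
    exact (hd.differentiableAt (by simp)).hasFDerivAt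
  · exact ⟨hfa.mem_toOpenPartialHomeomorph_source hf' (by simp), ha, f', hf'.fderiv.symm⟩
  · intro y hy
    rfl

/-- Restriction of the codomain of a local diffeomorphism to an open set. -/
theorem isLocalDiffeomorphAt_subtype_val (U : TopologicalSpace.Opens M) (x : U)  :
    IsLocalDiffeomorphAt I I ∞ (Subtype.val : U → M) x := by
  classical
  let e := U.openPartialHomeomorphSubtypeCoe ⟨x⟩
  refine ⟨{ e with
      contMDiffOn_toFun := ?_
      contMDiffOn_invFun := ?_ }, ?_, ?_⟩
  · exact contMDiff_subtype_val.contMDiffOn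
  · have h : ContMDiffOn I I ∞ e.symm e.target := by
      intro y hy
      rw [← ContMDiffWithinAt.subtypeVal_comp_iff]
      refine contMDiffWithinAt_id.congr (fun z hz => ?_) ?_
      · exact e.right_inv hz
      · exact e.right_inv hy
    exact h
  · simp [e]
  · intro y hy
    rfl

end LocalDiffeomorphisms

section
variable {n : ℕ} {M : Type*} [TopologicalSpace M] [ChartedSpace (Euc n) M]

theorem isLocalDiffeomorphAt_of_mem_maximalAtlas {e : OpenPartialHomeomorph M (Euc n)}
    (he : e ∈ IsManifold.maximalAtlas (𝓡 n) ∞ M) {x : M} (hx : x ∈ e.source) :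
    IsLocalDiffeomorphAt (𝓡 n) (𝓡 n) ∞ e x :=
  ⟨{ e with
      contMDiffOn_toFun := contMDiffOn_of_mem_maximalAtlas he
      contMDiffOn_invFun := contMDiffOn_symm_of_mem_maximalAtlas he }, hx, fun _ _ => rfl⟩

theorem isLocalDiffeomorphAt_symm_of_mem_maximalAtlas {e : OpenPartialHomeomorph M (Euc n)}
    (he : e ∈ IsManifold.maximalAtlas (𝓡 n) ∞ M) {y : Euc n} (hy : y ∈ e.target) :
    IsLocalDiffeomorphAt (𝓡 n) (𝓡 n) ∞ e.symm y :=
  ⟨{ e.symm with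
      contMDiffOn_toFun := contMDiffOn_symm_of_mem_maximalAtlas he
      contMDiffOn_invFun := contMDiffOn_of_mem_maximalAtlas he }, hy, fun _ _ => rfl⟩

/-- The inverse function theorem for a map to a manifold. -/
theorem isLocalDiffeomorphAt_of_mfderiv_surjective [IsManifold (𝓡 n) ∞ M] {f : Euc n → M} {U : Set (Euc n)}
    (hU : IsOpen U) (hf : ContMDiffOn (𝓡 n) (𝓡 n) ∞ f U) {a : Euc n} (ha : a ∈ U)
    (hsurj : Function.Surjective (mfderiv (𝓡 n) (𝓡 n) f a)) :
    IsLocalDiffeomorphAt (𝓡 n) (𝓡 n) ∞ f a := by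
  let φ := chartAt (Euc n) (f a)
  have hφ : φ ∈ IsManifold.maximalAtlas (𝓡 n) ∞ M := IsManifold.chart_mem_maximalAtlas (f a)
  have hφd := isLocalDiffeomorphAt_of_mem_maximalAtlas hφ (mem_chart_source _ (f a))
  have hfa : ContMDiffAt (𝓡 n) (𝓡 n) ∞ f a := hf.contMDiffAt (hU.mem_nhds ha)
  let V := U ∩ f ⁻¹' φ.source
  have hV : IsOpen V := hf.continuousOn.isOpen_inter_preimage hU φ.open_source
  have haV : a ∈ V := ⟨ha, mem_chart_source _ _⟩
  have hsm : ContDiffOn ℝ ∞ (φ ∘ f) V := by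
    rw [← contMDiffOn_iff_contDiffOn]
    exact (contMDiffOn_of_mem_maximalAtlas hφ).comp (hf.mono inter_subset_left) inter_subset_right
  have hd : HasFDerivAt (φ ∘ f) (fderiv ℝ (φ ∘ f) a) a :=
    ((hsm.contDiffAt (hV.mem_nhds haV)).differentiableAt (by simp)).hasFDerivAt
  have hcomp : fderiv ℝ (φ ∘ f) a =
      (mfderiv (𝓡 n) (𝓡 n) φ (f a)).comp (mfderiv (𝓡 n) (𝓡 n) f a) := by
    rw [← mfderiv_eq_fderiv]
    exact mfderiv_comp a (hφd.mdifferentiableAt (by simp)) (hfa.mdifferentiableAt (by simp))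
  have hsurj' : Function.Surjective (fderiv ℝ (φ ∘ f) a) := by
    rw [hcomp]
    have h2 : Function.Surjective (mfderiv (𝓡 n) (𝓡 n) φ (f a)) :=
      (hφd.mfderivToContinuousLinearEquiv (by simp)).surjective
    exact h2.comp hsurj
  have hinj' : Function.Injective (fderiv ℝ (φ ∘ f) a : Euc n →ₗ[ℝ] Euc n) :=
    LinearMap.injective_iff_surjective.mpr hsurj'
  let L : Euc n ≃L[ℝ] Euc n :=
    (LinearEquiv.ofInjectiveEndo (fderiv ℝ (φ ∘ f) a : Euc n →ₗ[ℝ] Euc n)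
      hinj').toContinuousLinearEquiv
  have hL : (L : Euc n →L[ℝ] Euc n) = fderiv ℝ (φ ∘ f) a := by ext; rfl
  refine isLocalDiffeomorphAt_of_comp_left
    (isLocalDiffeomorphAt_of_hasFDerivAt hV hsm haV L (hL ▸ hd)) hφd hfa.continuousAt ?_
  exact Filter.EventuallyEq.rfl

end

/-! ### Radial reparametrisation of the attached balls -/

theorem strictAntiOn_of_contDiffOn_of_deriv_neg {G : ℝ → ℝ} (hG : ContDiffOn ℝ ∞ G (Ioi 0))
    (hG' : ∀ t > 0, deriv G t < 0) : StrictAntiOn G (Ioi 0) :=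
  strictAntiOn_of_deriv_neg (convex_Ioi 0) hG.continuousOn
    (by rw [interior_Ioi]; exact hG')

/-- The radial function of the diffeomorphism `univUnitBall` from `ℝⁿ` to its unit ball. -/
noncomputable def ballRadius (t : ℝ) : ℝ := (√(1 + t ^ 2))⁻¹ * t

theorem univUnitBall_smul {n : ℕ} (t : ℝ) {ξ : Euc n} (hξ : ‖ξ‖ = 1) :
    OpenPartialHomeomorph.univUnitBall (t • ξ) = ballRadius t • ξ := by
  simp [OpenPartialHomeomorph.univUnitBall_apply, ballRadius, norm_smul, hξ, smul_smul]

theorem contDiff_ballRadius : ContDiff ℝ ∞ ballRadius := by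
  have h : ∀ x : ℝ, 1 + x ^ 2 ≠ 0 := fun x => by positivity
  refine ContDiff.mul (ContDiff.inv ?_ fun x => Real.sqrt_ne_zero'.mpr (by positivity)) contDiff_id
  exact ContDiff.sqrt (by fun_prop) h

theorem deriv_ballRadius_pos (t : ℝ) : 0 < deriv ballRadius t := by
  have h : (0 : ℝ) < 1 + t ^ 2 := by positivity
  have hs : 0 < √(1 + t ^ 2) := Real.sqrt_pos.mpr h
  have h1 : HasDerivAt (fun t : ℝ => 1 + t ^ 2) (2 * t) t := by
    simpa using ((hasDerivAt_id t).pow 2).const_add 1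
  have h2 := ((h1.sqrt h.ne').inv hs.ne').mul (hasDerivAt_id t)
  have h3 : deriv ballRadius t = _ := h2.deriv
  rw [h3]
  have hsq : √(1 + t ^ 2) ^ 2 = 1 + t ^ 2 := Real.sq_sqrt h.le
  simp only [id, Pi.inv_apply]
  rw [hsq]
  have : -(2 * t / (2 * √(1 + t ^ 2))) / (1 + t ^ 2) * t + (√(1 + t ^ 2))⁻¹ * 1
      = (√(1 + t ^ 2))⁻¹ / (1 + t ^ 2) := by
    field_simp
    ring
  rw [this]
  positivity

theorem ballRadius_mem {t : ℝ} (ht : 0 < t) : ballRadius t ∈ Ioo (0 : ℝ) 1 := by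
  have hs : 0 < √(1 + t ^ 2) := Real.sqrt_pos.mpr (by positivity)
  refine ⟨mul_pos (inv_pos.mpr hs) ht, ?_⟩
  rw [ballRadius, inv_mul_lt_one₀ hs]
  exact Real.lt_sqrt_of_sq_lt (by linarith)

theorem exists_ballRadius_eq {r : ℝ} (hr : r ∈ Ioo (0 : ℝ) 1) : ∃ t > 0, ballRadius t = r := by
  have h : 0 < 1 - r ^ 2 := by nlinarith [hr.1, hr.2]
  have hs : 0 < √(1 - r ^ 2) := Real.sqrt_pos.mpr h
  -- The inverse function of t / √(1 + t²).
  refine ⟨(√(1 - r ^ 2))⁻¹ * r, mul_pos (inv_pos.mpr hs) hr.1, ?_⟩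
  have : 1 + ((√(1 - r ^ 2))⁻¹ * r) ^ 2 = ((√(1 - r ^ 2))⁻¹) ^ 2 := by
    have := Real.sq_sqrt h.le
    field_simp
    rw [this]; ring
  rw [ballRadius, this, Real.sqrt_sq (by positivity)]
  field_simp

section

variable {n d : ℕ} {M M' : Type*} [TopologicalSpace M'] [ChartedSpace (Euc n) M']

/-- `IsDisc` asks for an embedding of all of ℝⁿ, whereas an attached ball is parametrised by the
open unit ball. The dilation by `r` leaves the radial scale free, so that the collar can later be
placed at a chosen radius. -/
theorem isDisc_comp_univUnitBall {c : Euc n → M'}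
    (hc : IsLocalDiffeomorphOn (𝓡 n) (𝓡 n) ∞ c (Metric.ball 0 1)) (hc' : InjOn c (Metric.ball 0 1))
    {r : ℝ} (hr : 0 < r) :
    IsDisc (fun x => c (OpenPartialHomeomorph.univUnitBall (r • x))) := by
  have hmem : ∀ x : Euc n, OpenPartialHomeomorph.univUnitBall (r • x) ∈ Metric.ball (0 : Euc n) 1 :=
    fun x => OpenPartialHomeomorph.univUnitBall.map_source (mem_univ _)
  constructor
  · intro x
    have h1 : IsLocalDiffeomorphAt (𝓡 n) (𝓡 n) ∞ (fun x : Euc n => r • x) x :=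
      isLocalDiffeomorphAt_of_hasFDerivAt isOpen_univ (contDiff_const_smul r).contDiffOn
        (mem_univ x) (ContinuousLinearEquiv.smulLeft (Units.mk0 r hr.ne'))
        ((hasFDerivAt_id x).const_smul r)
    have h2 : IsLocalDiffeomorphAt (𝓡 n) (𝓡 n) ∞
        (OpenPartialHomeomorph.univUnitBall : OpenPartialHomeomorph (Euc n) (Euc n)) (r • x) :=
      ⟨{ (OpenPartialHomeomorph.univUnitBall : OpenPartialHomeomorph (Euc n) (Euc n)) with
          contMDiffOn_toFun :=
            OpenPartialHomeomorph.contDiff_univUnitBall.contDiffOn.contMDiffOn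
          contMDiffOn_invFun :=
            OpenPartialHomeomorph.contDiffOn_univUnitBall_symm.contMDiffOn },
        by simp [OpenPartialHomeomorph.univUnitBall], fun _ _ => rfl⟩
    exact (h1.comp _ _ h2).comp _ _ (hc ⟨_, hmem x⟩)
  · intro x y hxy
    have := hc' (hmem x) (hmem y) hxy
    have := OpenPartialHomeomorph.univUnitBall.injOn (mem_univ _) (mem_univ _) this
    exact smul_right_injective _ hr.ne' this

/-- The ball attached in the surgery, reparametrised as a disc with all of `ℝⁿ` as its domain. -/
theorem IsAttachedCap.exists_disc {F : M → Euc d} {N : Euc n → ℝ → M} {Λ τ B : ℝ} {φ : ℝ → ℝ}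
    {Q : Euc n →ₗᵢ[ℝ] Euc d} {F' : M' → Euc d} {j : M → M'} {s : ℝ} {c : Euc n → M'}
    (hΛ : 0 < Λ) (h : IsAttachedCap F N Λ τ B φ Q F' j s c) :
    ∃ (i : Euc n → M') (θ : ℝ → ℝ) (z₁ : ℝ), z₁ ∈ Ioc (3 * Λ) (4 * Λ) ∧
      IsDisc i ∧ range i = c '' Metric.ball 0 1 ∧ ContDiffOn ℝ ∞ θ (Ioi 0) ∧
      (∀ t > 0, deriv θ t < 0) ∧ θ '' Ioi 0 = Ioo 0 z₁ ∧ θ 4 = Λ ∧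
      (∀ ξ : Euc n, ‖ξ‖ = 1 → ∀ t > 0, θ t < Λ → i (t • ξ) = j (N ξ (s * (θ t - 4 * Λ)))) ∧
      (∀ x ∉ core N Λ, j x ∈ range i →
        ∃ ξ : Euc n, ‖ξ‖ = 1 ∧ ∃ ζ ∈ Ioo 0 Λ, x = N ξ (s * (ζ - 4 * Λ))) := by
  obtain ⟨u, θ, z₁, hu, hθ, hθ', him, hc, hc', -, hcol, hcol'⟩ := h
  have hz := hu.mem
  obtain ⟨t₀, ht₀, htΛ⟩ : Λ ∈ θ '' Ioo 0 1 := by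
    rw [him]; exact ⟨hΛ, by linarith [hz.1]⟩
  obtain ⟨r₀, hr₀, hr⟩ := exists_ballRadius_eq ht₀
  -- With this scale the edge ζ = Λ of the collar lies at radius 4. The radii below 4 are then free
  -- for changing the profile without touching the attaching region.
  have hr4 : 0 < r₀ / 4 := by positivity
  have hmaps : ∀ t > 0, ballRadius (r₀ / 4 * t) ∈ Ioo (0 : ℝ) 1 :=
    fun t ht => ballRadius_mem (by positivity)
  have hsm : ContDiff ℝ ∞ fun t => ballRadius (r₀ / 4 * t) :=
    contDiff_ballRadius.comp (contDiff_const.mul contDiff_id)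
  have hrange : range (fun x => c (OpenPartialHomeomorph.univUnitBall ((r₀ / 4) • x))) =
      c '' Metric.ball 0 1 := by
    ext y
    constructor
    · rintro ⟨x, rfl⟩
      exact ⟨_, OpenPartialHomeomorph.univUnitBall.map_source (mem_univ _), rfl⟩
    · rintro ⟨x, hx, rfl⟩
      refine ⟨(r₀ / 4)⁻¹ • OpenPartialHomeomorph.univUnitBall.symm x, ?_⟩
      simp only [smul_smul, mul_inv_cancel₀ hr4.ne', one_smul]
      rw [OpenPartialHomeomorph.univUnitBall.right_inv hx]
  refine ⟨_, fun t => θ (ballRadius (r₀ / 4 * t)), z₁, hz, isDisc_comp_univUnitBall hc hc' hr4,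
    hrange, hθ.comp hsm.contDiffOn hmaps, fun t ht => ?_, ?_, ?_, ?_, ?_⟩
  · have h1 : DifferentiableAt ℝ θ (ballRadius (r₀ / 4 * t)) :=
      (hθ.contDiffAt (Ioo_mem_nhds (hmaps t ht).1 (hmaps t ht).2)).differentiableAt (by simp)
    have h2 : HasDerivAt (fun t => ballRadius (r₀ / 4 * t))
        (deriv ballRadius (r₀ / 4 * t) * (r₀ / 4)) t := by
      have h3 : HasDerivAt ballRadius (deriv ballRadius (r₀ / 4 * t)) (r₀ / 4 * t) :=
        (contDiff_ballRadius.differentiable (by simp) _).hasDerivAt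
      exact h3.comp t (by simpa using (hasDerivAt_id t).const_mul (r₀ / 4))
    have h4 := (h1.hasDerivAt.comp t h2).deriv
    have h5 : deriv (fun t => θ (ballRadius (r₀ / 4 * t))) t = _ := h4
    rw [h5]
    exact mul_neg_of_neg_of_pos (hθ' _ (hmaps t ht)) (mul_pos (deriv_ballRadius_pos _) hr4)
  · rw [← him]
    ext y
    constructor
    · rintro ⟨t, ht, rfl⟩
      exact ⟨_, hmaps t ht, rfl⟩
    · rintro ⟨t, ht, rfl⟩
      obtain ⟨r, hr0, hr1⟩ := exists_ballRadius_eq ht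
      refine ⟨r / (r₀ / 4), by simp only [mem_Ioi]; positivity, ?_⟩
      simp only
      rw [mul_div_cancel₀ _ hr4.ne', hr1]
  · simp only
    rw [div_mul_cancel₀ _ (by norm_num), hr, htΛ]
  · intro ξ hξ t ht hlt
    simp only [smul_smul]
    rw [univUnitBall_smul _ hξ]
    exact hcol ξ hξ _ (hmaps t ht) hlt
  · rw [hrange]
    exact hcol'

end

/-- A decreasing function which is linear near zero and agrees with `θ - 4 Λ` far from zero. -/
theorem exists_profile {Λ z₁ : ℝ} {θ : ℝ → ℝ}
    (hθ : ContDiffOn ℝ ∞ θ (Ioi 0)) (hθ' : ∀ t > 0, deriv θ t < 0)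
    (him : θ '' Ioi 0 = Ioo 0 z₁) {K : ℝ} (hK : 0 < K) (hK' : 4 * K ≤ 4 * Λ - θ 2) :
    ∃ G : ℝ → ℝ, ContDiffOn ℝ ∞ G (Ioi 0) ∧ (∀ t > 0, deriv G t < 0) ∧
      (∀ t ≤ 2, G t = K * (1 / 2 - t)) ∧ (∀ t ≥ 4, G t = θ t - 4 * Λ) ∧
      G '' Ioi 0 = Ioo (-(4 * Λ)) (K / 2) := by
  -- A cutoff that rises from 0 at radius 2 to 1 at radius 4.
  set χ : ℝ → ℝ := fun t => Real.smoothTransition ((t - 2) / 2) with hχ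
  have hχs : ContDiff ℝ ∞ χ := Real.smoothTransition.contDiff.comp (by fun_prop)
  have hχ0 : ∀ t ≤ 2, χ t = 0 := fun t ht =>
    Real.smoothTransition.zero_of_nonpos (by linarith)
  have hχ1 : ∀ t ≥ 4, χ t = 1 := fun t ht =>
    Real.smoothTransition.one_of_one_le (by linarith)
  have hχm : Monotone χ := fun a b hab => by
    apply Real.smoothTransition.monotone
    gcongr
  have hχn : ∀ t, 0 ≤ χ t := fun t => Real.smoothTransition.nonneg _
  have hχl : ∀ t, χ t ≤ 1 := fun t => Real.smoothTransition.le_one _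
  have hanti := strictAntiOn_of_contDiffOn_of_deriv_neg hθ hθ'
  set G : ℝ → ℝ := fun t => χ t * (θ t - 4 * Λ) + (1 - χ t) * (K * (1 / 2 - t)) with hGdef
  have hG2 : ∀ t ≤ 2, G t = K * (1 / 2 - t) := fun t ht => by simp [G, hχ0 t ht]
  have hG4 : ∀ t ≥ 4, G t = θ t - 4 * Λ := fun t ht => by simp [G, hχ1 t ht]
  have hGs : ContDiffOn ℝ ∞ G (Ioi 0) := by
    refine (hχs.contDiffOn.mul (hθ.sub contDiffOn_const)).add (ContDiff.contDiffOn ?_)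
    exact (contDiff_const.sub hχs).mul (by fun_prop)
  have hGd : ∀ t > 0, deriv G t < 0 := by
    intro t ht
    have hd : HasDerivAt θ (deriv θ t) t :=
      ((hθ.contDiffAt (Ioi_mem_nhds ht)).differentiableAt (by simp)).hasDerivAt
    have hdχ : HasDerivAt χ (deriv χ t) t := (hχs.differentiable (by simp) t).hasDerivAt
    have hl : HasDerivAt (fun t => K * (1 / 2 - t)) (-K) t := by
      simpa [-one_div] using ((hasDerivAt_id t).const_sub (1 / 2)).const_mul K
    have hG : HasDerivAt G (deriv χ t * (θ t - 4 * Λ) + χ t * deriv θ t +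
        (-deriv χ t * (K * (1 / 2 - t)) + (1 - χ t) * -K)) t :=
      (hdχ.mul (hd.sub_const _)).add ((hdχ.const_sub 1).mul hl)
    have hχ' : 0 ≤ deriv χ t := hχm.deriv_nonneg
    -- The interpolation stays decreasing because it passes from the larger function to the smaller
    -- one: for 2 ≤ t ≤ 4, θ t - 4Λ ≤ θ 2 - 4Λ ≤ -4K ≤ K(1/2 - t).
    have key : deriv χ t * (θ t - 4 * Λ - K * (1 / 2 - t)) ≤ 0 := by
      rcases lt_or_ge t 2 with h2 | h2
      · have : deriv χ t = 0 := by
          have : χ =ᶠ[nhds t] fun _ => 0 := by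
            filter_upwards [Iio_mem_nhds h2] with y hy using hχ0 y (le_of_lt hy)
          rw [this.deriv_eq]; simp
        simp [this]
      rcases lt_or_ge 4 t with h4 | h4
      · have : deriv χ t = 0 := by
          have : χ =ᶠ[nhds t] fun _ => 1 := by
            filter_upwards [Ioi_mem_nhds h4] with y hy using hχ1 y (le_of_lt hy)
          rw [this.deriv_eq]; simp
        simp [this]
      · refine mul_nonpos_of_nonneg_of_nonpos hχ' ?_
        have : θ t ≤ θ 2 := hanti.antitoneOn (by norm_num : (2 : ℝ) ∈ Ioi 0) ht h2
        nlinarith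
    rw [hG.deriv]
    have h3 : χ t * deriv θ t + (1 - χ t) * -K < 0 := by
      rcases (hχn t).eq_or_lt with h0 | h0
      · rw [← h0]; linarith
      · have := mul_neg_of_pos_of_neg h0 (hθ' t ht)
        nlinarith [hχl t]
    linarith
  have hGa := strictAntiOn_of_contDiffOn_of_deriv_neg hGs hGd
  have hθm : ∀ t > 0, θ t ∈ Ioo 0 z₁ := fun t ht => him ▸ mem_image_of_mem θ ht
  refine ⟨G, hGs, hGd, hG2, hG4, ?_⟩
  ext y
  constructor
  · rintro ⟨t, ht, rfl⟩
    have ht : 0 < t := ht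
    constructor
    · have h1 : G (max t 4) ≤ G t := hGa.antitoneOn ht (by simp) (le_max_left _ _)
      rw [hG4 _ (le_max_right _ _)] at h1
      linarith [(hθm (max t 4) (by positivity)).1]
    · have h1 : G t ≤ G (min t 2) := hGa.antitoneOn (by simpa using ht) ht (min_le_left _ _)
      rw [hG2 _ (min_le_right _ _)] at h1
      have : 0 < K * min t 2 := by positivity
      linarith
  · rintro ⟨hy1, hy2⟩
    -- The first bound forces b > 4, where G is θ - 4Λ; the second gives G b ≤ y.
    obtain ⟨b, hb, hθb⟩ : min (θ 4 / 2) ((y + 4 * Λ) / 2) ∈ θ '' Ioi 0 := by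
      have h4 := hθm 4 (by norm_num)
      rw [him]
      refine ⟨lt_min (by linarith [h4.1]) (by linarith), ?_⟩
      exact (min_le_left _ _).trans_lt (by linarith [h4.1, h4.2])
    have hb4 : 4 < b := by
      by_contra hcon
      have := hanti.antitoneOn hb (by norm_num : (4 : ℝ) ∈ Ioi 0) (not_lt.mp hcon)
      rw [hθb] at this
      have := this.trans (min_le_left _ _)
      linarith [(hθm 4 (by norm_num)).1]
    have hGb : G b ≤ y := by
      rw [hG4 b hb4.le, hθb]
      linarith [min_le_right (θ 4 / 2) ((y + 4 * Λ) / 2)]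
    -- Here G is linear, and K(1/2 - t) ≥ y as soon as t ≤ (K/2 - y)/K.
    set a := min 2 ((K / 2 - y) / K) with ha
    have ha0 : 0 < a := lt_min (by norm_num) (div_pos (by linarith) hK)
    have hGa' : y ≤ G a := by
      rw [hG2 a (min_le_left _ _)]
      have := mul_le_mul_of_nonneg_left (min_le_right 2 ((K / 2 - y) / K)) hK.le
      rw [mul_div_cancel₀ _ hK.ne'] at this
      linarith
    have hab : a ≤ b := (min_le_left _ _).trans (by linarith)
    obtain ⟨t, ht, rfl⟩ := intermediate_value_Icc' hab
      (hGs.continuousOn.mono fun t ht => ha0.trans_le ht.1) ⟨hGb, hGa'⟩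
    exact ⟨t, ha0.trans_le ht.1, rfl⟩

/-! ### Necks in polar coordinates -/

section

open Filter Topology

variable {n : ℕ}

theorem radialExt_pt {β : Type*} (f : Euc n → ℝ → β) (x : Euc n) (z : ℝ) :
    radialExt f (pt x z) = f (‖x‖⁻¹ • x) z := rfl

theorem pt_smul_add (r : ℝ) (x y : Euc n) (z w : ℝ) :
    pt (y + r • x) (w + r * z) = pt y w + r • pt x z := rfl

/-- `(x, z) ↦ pt x z` as a linear map. -/
noncomputable def ptCLM (n : ℕ) : (Euc n × ℝ) →L[ℝ] Cyl n :=
  (WithLp.prodContinuousLinearEquiv 2 ℝ (Euc n) ℝ).symm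

theorem isOpen_tube {I : Set ℝ} (hI : IsOpen I) : IsOpen (tube n I) := by
  have h1 : Continuous fun p : Cyl n => p.fst := by fun_prop
  have h2 : Continuous fun p : Cyl n => p.snd := by fun_prop
  exact (isOpen_ne.preimage h1).inter (hI.preimage h2)

/-- The composition of a surjective map, whose kernel contains `(x, 0)`, with `v ↦ (v, ℓ v)`. -/
theorem surjective_comp_graph {T : Cyl n →L[ℝ] Euc n} (hT : Function.Surjective T) {x : Euc n}
    (hTx : T (pt x 0) = 0) {ℓ : Euc n →L[ℝ] ℝ} (hℓ : ℓ x ≠ 0) :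
    Function.Surjective (T.comp ((ptCLM n).comp ((ContinuousLinearMap.id ℝ (Euc n)).prod ℓ))) := by
  intro y
  obtain ⟨w, hw⟩ := hT y
  -- Moving `w.fst` along `x` does not change the value of `T`, and this amount brings `ℓ` to the
  -- axial component of `w`.
  set r := (w.snd - ℓ w.fst) / ℓ x
  refine ⟨w.fst + r • x, ?_⟩
  have h6 : ℓ (w.fst + r • x) = w.snd + r * 0 := by
    rw [map_add, map_smul, smul_eq_mul, div_mul_cancel₀ _ hℓ]; ring
  change T (pt (w.fst + r • x) (ℓ (w.fst + r • x))) = y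
  rw [h6, pt_smul_add, map_add, map_smul, hTx, smul_zero, add_zero]
  exact hw

variable {M : Type*} [TopologicalSpace M] [ChartedSpace (Euc n) M]

/-- The differential of a map vanishes on a direction along which the map is constant. -/
theorem mfderiv_apply_eq_zero_of_eventually_const {E : Type*} [NormedAddCommGroup E]
    [NormedSpace ℝ E] {f : E → M} {p v : E} (hf : MDifferentiableAt 𝓘(ℝ, E) (𝓡 n) f p)
    (h : ∀ᶠ t in 𝓝 (0 : ℝ), f (p + t • v) = f p) :
    (mfderiv 𝓘(ℝ, E) (𝓡 n) f p) v = (0 : Euc n) := by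
  set γ : ℝ → E := fun t => p + t • v with hγ
  have hγ' : HasDerivAt γ v 0 := by
    have h0 := ((hasDerivAt_id (0 : ℝ)).smul_const v).const_add p
    rwa [one_smul] at h0
  have hγ0 : γ 0 = p := by simp [γ]
  have hconst : f ∘ γ =ᶠ[𝓝 0] fun _ => f p := h
  have h2 : mfderiv 𝓘(ℝ, ℝ) (𝓡 n) (f ∘ γ) 0 = 0 := by
    rw [hconst.mfderiv_eq]; exact mfderiv_const
  have h3 := mfderiv_comp (I := 𝓘(ℝ, ℝ)) (I' := 𝓘(ℝ, E)) (I'' := 𝓡 n) (f := γ)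
    (g := f) (0 : ℝ) (by rw [hγ0]; exact hf) hγ'.differentiableAt.mdifferentiableAt
  rw [h2, mfderiv_eq_fderiv, hγ'.hasFDerivAt.fderiv] at h3
  have h5 : (0 : Euc n) = (mfderiv 𝓘(ℝ, E) (𝓡 n) f (γ 0)) ((1 : ℝ) • v) :=
    congrArg (fun L => L (1 : ℝ)) h3
  rw [hγ0, one_smul] at h5
  exact h5.symm

/-- A neck in polar coordinates, with the axial coordinate a strictly monotone function of the
radius, is a local diffeomorphism away from the origin. -/
theorem IsTopologicalNeck.isLocalDiffeomorphAt_polar [IsManifold (𝓡 n) ∞ M] {N : Euc n → ℝ → M}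
    {a b : ℝ} (hN : IsTopologicalNeck N a b) {g : ℝ → ℝ} (hg : ContDiffOn ℝ ∞ g (Ioi 0))
    (hg' : ∀ t > 0, deriv g t ≠ 0) (hgm : ∀ t > 0, g t ∈ Ioo a b) {x : Euc n} (hx : x ≠ 0) :
    IsLocalDiffeomorphAt (𝓡 n) (𝓡 n) ∞ (fun v : Euc n => N (‖v‖⁻¹ • v) (g ‖v‖)) x := by
  have hx' : 0 < ‖x‖ := norm_pos_iff.mpr hx
  have hsub : tube n (Ioo a b) ⊆ tube n (Icc a b) := fun p hp => ⟨hp.1, Ioo_subset_Icc_self hp.2⟩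
  have ho : IsOpen (tube n (Ioo a b)) := isOpen_tube isOpen_Ioo
  have hU : IsOpen ({0}ᶜ : Set (Euc n)) := isOpen_compl_singleton
  -- The map is `radialExt N ∘ q`. The differential of `radialExt N` kills the ray direction, and
  -- the graph of g(|v|) is transverse to it because g' ≠ 0, so the composition keeps a surjective
  -- differential.
  set q : Euc n → Cyl n := fun v => pt v (g ‖v‖) with hq
  have hgn : ContDiffOn ℝ ∞ (fun v : Euc n => g ‖v‖) {0}ᶜ :=
    hg.comp (fun v hv => (contDiffAt_norm ℝ hv).contDiffWithinAt) fun v hv => norm_pos_iff.mpr hv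
  have hqs : ContDiffOn ℝ ∞ q {0}ᶜ :=
    (ptCLM n).contDiff.comp_contDiffOn (contDiffOn_id.prodMk hgn)
  have hqm : ∀ v ∈ ({0}ᶜ : Set (Euc n)), q v ∈ tube n (Ioo a b) :=
    fun v hv => ⟨hv, hgm _ (norm_pos_iff.mpr hv)⟩
  have hNs : ContMDiffOn 𝓘(ℝ, Cyl n) (𝓡 n) ∞ (radialExt N) (tube n (Ioo a b)) :=
    hN.smooth.mono hsub
  have hcomp : ContMDiffOn (𝓡 n) (𝓡 n) ∞ (radialExt N ∘ q) {0}ᶜ :=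
    hNs.comp hqs.contMDiffOn hqm
  have hnhds : tube n (Ioo a b) ∈ 𝓝 (q x) := ho.mem_nhds (hqm x hx)
  set T := mfderiv 𝓘(ℝ, Cyl n) (𝓡 n) (radialExt N) (q x) with hT
  have hTd : MDifferentiableAt 𝓘(ℝ, Cyl n) (𝓡 n) (radialExt N) (q x) :=
    (hNs.contMDiffAt hnhds).mdifferentiableAt (by simp)
  have hTsurj : Function.Surjective T := by
    have := hN.submersive (q x) (hsub (hqm x hx))
    rwa [mfderivWithin_of_mem_nhds (mem_of_superset hnhds hsub)] at this
  have hTrad : T (pt x 0) = 0 := by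
    refine mfderiv_apply_eq_zero_of_eventually_const hTd ?_
    filter_upwards [Ioi_mem_nhds (show (-1 : ℝ) < 0 by norm_num)] with t ht
    have ht : 0 < 1 + t := by linarith [mem_Ioi.mp ht]
    have h1 : q x + t • pt x 0 = pt ((1 + t) • x) (g ‖x‖) := by
      rw [← pt_smul_add, add_smul, one_smul, mul_zero, add_zero]
    rw [h1, radialExt_pt, radialExt_pt, norm_smul, smul_smul, Real.norm_of_nonneg ht.le]
    congr 2
    field_simp
  have hgd : HasFDerivAt (fun v : Euc n => g ‖v‖) (deriv g ‖x‖ • fderiv ℝ (‖·‖) x) x := by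
    have h1 : HasDerivAt g (deriv g ‖x‖) ‖x‖ :=
      ((hg.contDiffAt (Ioi_mem_nhds hx')).differentiableAt (by simp)).hasDerivAt
    have h2 : HasFDerivAt (fun v : Euc n => ‖v‖) (fderiv ℝ (‖·‖) x) x :=
      ((contDiffAt_norm (n := 1) ℝ hx).differentiableAt (by simp)).hasFDerivAt
    exact h1.comp_hasFDerivAt x h2
  have hqd := (ptCLM n).hasFDerivAt.comp x ((hasFDerivAt_id x).prodMk hgd)
  replace hqd : HasFDerivAt q _ x := hqd
  have hnx : fderiv ℝ (fun v : Euc n => ‖v‖) x x = ‖x‖ :=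
    ((contDiffAt_norm (n := 1) ℝ hx).differentiableAt (by simp)).fderiv_norm_self
  refine isLocalDiffeomorphAt_of_mfderiv_surjective (f := radialExt N ∘ q) hU hcomp hx ?_
  have hchain := (hTd.hasMFDerivAt.comp x hqd.hasMFDerivAt).mfderiv
  rw [hchain]
  refine surjective_comp_graph hTsurj hTrad ?_
  rw [smul_apply, hnx, smul_eq_mul]
  exact mul_ne_zero (hg' _ hx') hx'.ne'

end

/-! ### The gluing map from the manifold after surgery -/

section

open Filter Topology

variable {n d : ℕ} {M M' : Type*} [TopologicalSpace M'] [ChartedSpace (Euc n) M']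

/-- A half of a neck in polar coordinates, with axial coordinate `s G` as a function of the
radius. -/
noncomputable def polarNeck (N : Euc n → ℝ → M) (s : ℝ) (G : ℝ → ℝ) (v : Euc n) : M :=
  N (‖v‖⁻¹ • v) (s * G ‖v‖)

theorem polarNeck_smul (N : Euc n → ℝ → M) (s : ℝ) (G : ℝ → ℝ) {ξ : Euc n} (hξ : ‖ξ‖ = 1) {t : ℝ}
    (ht : 0 < t) : polarNeck N s G (t • ξ) = N ξ (s * G t) := by
  have : ‖t • ξ‖ = t := by rw [norm_smul, hξ, mul_one, Real.norm_of_nonneg ht.le]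
  rw [polarNeck, this, smul_smul, inv_mul_cancel₀ ht.ne', one_smul]

/-- A disc `i` in the manifold after surgery, with a profile function `G` for which the collar
`G < - 3 Λ` of the disc is attached by `j` along the neck `N`. -/
structure IsCollarDisc (N : Euc n → ℝ → M) (Λ K s : ℝ) (j : M → M') (i : Euc n → M')
    (G : ℝ → ℝ) : Prop where
  isDisc : IsDisc i
  smooth : ContDiffOn ℝ ∞ G (Ioi 0)
  deriv_neg : ∀ t > 0, deriv G t < 0
  eq_linear : ∀ t ≤ 2, G t = K * (1 / 2 - t)
  image : G '' Ioi 0 = Ioo (-(4 * Λ)) (K / 2)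
  collar : ∀ v : Euc n, v ≠ 0 → G ‖v‖ < -(3 * Λ) → i v = j (polarNeck N s G v)
  of_mem : ∀ x ∉ core N Λ, ∀ v, j x = i v → v ≠ 0 ∧ x = polarNeck N s G v

/-- Used in contrapositive form: a point of the polar neck outside the core satisfies G < -3Λ, which
is where the disc is known to be attached by `j`. The bound K ≤ Λ keeps the overshoot K/2 inside the
core. -/
theorem polarNeck_mem_core (N : Euc n → ℝ → M) {Λ K s : ℝ} (hs : s = 1 ∨ s = -1) {j : M → M'}
    {i : Euc n → M'} {G : ℝ → ℝ} (h : IsCollarDisc N Λ K s j i G) (hK : K ≤ Λ) (hΛ : 0 < Λ)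
    {v : Euc n} (hv : v ≠ 0) (hG : -(3 * Λ) ≤ G ‖v‖) : polarNeck N s G v ∈ core N Λ := by
  have hv' : 0 < ‖v‖ := norm_pos_iff.mpr hv
  have h1 : G ‖v‖ ∈ Ioo (-(4 * Λ)) (K / 2) := h.image ▸ mem_image_of_mem G hv'
  refine ⟨‖v‖⁻¹ • v, norm_smul_inv_norm hv, s * G ‖v‖, ?_, rfl⟩
  rcases hs with rfl | rfl
  · constructor <;> linarith [h1.2]
  · constructor <;> linarith [h1.2]

/-- The slope K stays free below a threshold because the two discs must share one K: only with equal
slopes does the identification read t ↔ 1 - t. The disc itself does not depend on K. -/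
theorem IsAttachedCap.exists_isCollarDisc {F : M → Euc d} {N : Euc n → ℝ → M} {Λ τ B : ℝ}
    {φ : ℝ → ℝ} {Q : Euc n →ₗᵢ[ℝ] Euc d} {F' : M' → Euc d} {j : M → M'} {s : ℝ} {c : Euc n → M'}
    (hΛ : 0 < Λ) (h : IsAttachedCap F N Λ τ B φ Q F' j s c) :
    ∃ (i : Euc n → M') (K₀ : ℝ), 0 < K₀ ∧ IsDisc i ∧ range i = c '' Metric.ball 0 1 ∧
      ∀ K > 0, K ≤ K₀ → ∃ G, IsCollarDisc N Λ K s j i G := by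
  obtain ⟨i, θ, z₁, hz, hi, hr, hθ, hθ', him, h4, hcol, hcol'⟩ := h.exists_disc hΛ
  have hanti := strictAntiOn_of_contDiffOn_of_deriv_neg hθ hθ'
  have h2 : θ 2 ∈ Ioo 0 z₁ := him ▸ mem_image_of_mem θ (by norm_num : (2 : ℝ) ∈ Ioi 0)
  -- The threshold is the condition 4K ≤ 4Λ - θ 2 of `exists_profile`; it is positive because θ 2 <
  -- z₁ ≤ 4Λ.
  refine ⟨i, (4 * Λ - θ 2) / 4, by linarith [h2.2, hz.2], hi, hr, fun K hK hK' => ?_⟩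
  obtain ⟨G, hG, hG', hG2, hG4, hGi⟩ := exists_profile (Λ := Λ) hθ hθ' him hK (by linarith)
  have hGa := strictAntiOn_of_contDiffOn_of_deriv_neg hG hG'
  refine ⟨G, hi, hG, hG', hG2, hGi, fun v hv hlt => ?_, fun x hx v hv => ?_⟩
  · have hv' : 0 < ‖v‖ := norm_pos_iff.mpr hv
    -- Since G 4 = Λ - 4Λ = -3Λ, the collar condition selects exactly the radii above 4, where G is
    -- the attaching coordinate.
    have h5 : 4 < ‖v‖ := by
      by_contra hcon
      have := hGa.antitoneOn hv' (by norm_num : (4 : ℝ) ∈ Ioi 0) (not_lt.mp hcon)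
      rw [hG4 4 le_rfl, h4] at this
      linarith
    have h6 := hcol (‖v‖⁻¹ • v) (norm_smul_inv_norm hv) ‖v‖ hv' (by
      rw [hG4 _ h5.le] at hlt; linarith)
    rw [smul_smul, mul_inv_cancel₀ hv'.ne', one_smul] at h6
    rw [h6, polarNeck, hG4 _ h5.le]
  · obtain ⟨ξ, hξ, ζ, hζ, rfl⟩ := hcol' x hx ⟨v, hv.symm⟩
    obtain ⟨t, ht, rfl⟩ : ζ ∈ θ '' Ioi 0 := by
      rw [him]; exact ⟨hζ.1, by linarith [hζ.2, hz.1]⟩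
    have ht0 : 0 < t := ht
    have ht4 : 4 < t := by
      by_contra hcon
      have := hanti.antitoneOn ht (by norm_num : (4 : ℝ) ∈ Ioi 0) (not_lt.mp hcon)
      linarith [hζ.2]
    have h7 : v = t • ξ := hi.2 (by rw [← hv, hcol ξ hξ t ht0 hζ.2])
    constructor
    · rw [h7]
      exact smul_ne_zero ht0.ne' (norm_ne_zero_iff.mp (by rw [hξ]; norm_num))
    · rw [h7, polarNeck_smul N s G hξ ht0, hG4 t ht4.le]

theorem norm_smul_inv_smul {v : Euc n} (hv : v ≠ 0) : ‖v‖ • (‖v‖⁻¹ • v) = v := by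
  rw [smul_smul, mul_inv_cancel₀ (norm_ne_zero_iff.mpr hv), one_smul]

theorem IsCollarDisc.exists_polarNeck_eq {N : Euc n → ℝ → M} {Λ K s : ℝ} {j : M → M'}
    {i : Euc n → M'} {G : ℝ → ℝ} (h : IsCollarDisc N Λ K s j i G) {ξ : Euc n} (hξ : ‖ξ‖ = 1)
    {z : ℝ} (hz : z ∈ Ioo (-(4 * Λ)) (K / 2)) : ∃ v ≠ 0, polarNeck N s G v = N ξ (s * z) := by
  obtain ⟨t, ht, rfl⟩ : z ∈ G '' Ioi 0 := h.image ▸ hz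
  have ht0 : 0 < t := ht
  exact ⟨t • ξ, smul_ne_zero ht0.ne' (norm_ne_zero_iff.mp (by rw [hξ]; norm_num)),
    polarNeck_smul N s G hξ ht0⟩

variable [TopologicalSpace M] [ChartedSpace (Euc n) M]

/-- The core is the continuous image of the compact cylinder over [-3Λ, 3Λ]. Closedness makes the
unchanged part open, so that the gluing map inverts `j` on a full neighbourhood of each of its
points. -/
theorem isClosed_core [T2Space M] {N : Euc n → ℝ → M} {Λ : ℝ} (hΛ : 0 ≤ Λ)
    (hN : IsTopologicalNeck N (-(4 * Λ)) (4 * Λ)) : IsClosed (core N Λ) := by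
  have hK : IsCompact (Metric.sphere (0 : Euc n) 1 ×ˢ Icc (-(3 * Λ)) (3 * Λ)) :=
    (isCompact_sphere _ _).prod isCompact_Icc
  have hc : ContinuousOn (fun p : Euc n × ℝ => radialExt N (ptCLM n p))
      (Metric.sphere (0 : Euc n) 1 ×ˢ Icc (-(3 * Λ)) (3 * Λ)) := by
    refine hN.smooth.continuousOn.comp (ptCLM n).continuous.continuousOn ?_
    rintro ⟨ξ, z⟩ ⟨hξ, hz⟩
    have hz : -(3 * Λ) ≤ z ∧ z ≤ 3 * Λ := hz
    change ξ ≠ 0 ∧ -(4 * Λ) ≤ z ∧ z ≤ 4 * Λ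
    refine ⟨?_, by linarith [hz.1], by linarith [hz.2]⟩
    exact ne_zero_of_mem_unit_sphere ⟨ξ, hξ⟩
  have : core N Λ = (fun p : Euc n × ℝ => radialExt N (ptCLM n p)) ''
      (Metric.sphere (0 : Euc n) 1 ×ˢ Icc (-(3 * Λ)) (3 * Λ)) := by
    ext x
    constructor
    · rintro ⟨ξ, hξ, z, hz, rfl⟩
      refine ⟨(ξ, z), ⟨by simpa using hξ, hz⟩, ?_⟩
      change N (‖ξ‖⁻¹ • ξ) z = _
      rw [hξ, inv_one, one_smul]
    · rintro ⟨⟨ξ, z⟩, ⟨hξ, hz⟩, rfl⟩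
      have hξ' : ‖ξ‖ = 1 := by simpa using hξ
      refine ⟨ξ, hξ', z, hz, ?_⟩
      change N (‖ξ‖⁻¹ • ξ) z = _
      rw [hξ', inv_one, one_smul]
  rw [this]
  exact (hK.image_of_continuousOn hc).isClosed

/-- `f` is the quotient map which glues the discs `i₁` and `i₂`, with disjoint ranges, to form
the connected sum of `M'` with itself. -/
structure IsSelfGluing (i₁ i₂ : Euc n → M') (f : M' → M) : Prop where
  disc₁ : IsDisc i₁
  disc₂ : IsDisc i₂
  disjoint : Disjoint (range i₁) (range i₂)
  localDiffeo : IsLocalDiffeomorphOn (𝓡 n) (𝓡 n) ∞ f {i₁ 0, i₂ 0}ᶜ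
  surj : f '' {i₁ 0, i₂ 0}ᶜ = univ
  eq_iff : ∀ x ∈ ({i₁ 0, i₂ 0}ᶜ : Set M'), ∀ y ∈ ({i₁ 0, i₂ 0}ᶜ : Set M'),
      f x = f y ↔ x = y ∨ Glued i₁ i₂ x y ∨ Glued i₁ i₂ y x

theorem IsCollarDisc.isLocalDiffeomorphAt_polarNeck [IsManifold (𝓡 n) ∞ M] {N : Euc n → ℝ → M}
    {Λ K s : ℝ} (hs : s = 1 ∨ s = -1) {j : M → M'} {i : Euc n → M'} {G : ℝ → ℝ}
    (h : IsCollarDisc N Λ K s j i G) (hK : K ≤ Λ) (hΛ : 0 < Λ)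
    (hN : IsTopologicalNeck N (-(4 * Λ)) (4 * Λ)) {v : Euc n} (hv : v ≠ 0) :
    IsLocalDiffeomorphAt (𝓡 n) (𝓡 n) ∞ (polarNeck N s G) v := by
  refine hN.isLocalDiffeomorphAt_polar (g := fun t => s * G t) (contDiffOn_const.mul h.smooth)
    (fun t ht => ?_) (fun t ht => ?_) hv
  · rw [deriv_const_mul _ ((h.smooth.contDiffAt (Ioi_mem_nhds ht)).differentiableAt (by simp))]
    have := h.deriv_neg t ht
    rcases hs with rfl | rfl <;> simp [this.ne]
  · have h1 : G t ∈ Ioo (-(4 * Λ)) (K / 2) := h.image ▸ mem_image_of_mem G ht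
    rcases hs with rfl | rfl <;> constructor <;> linarith [h1.1, h1.2]

theorem IsCollarDisc.polarNeck_eq {N : Euc n → ℝ → M} {Λ K s s' : ℝ} (hs : s = 1 ∨ s = -1)
    (hs' : s' = 1 ∨ s' = -1) {j : M → M'} {i i' : Euc n → M'} {G G' : ℝ → ℝ}
    (h : IsCollarDisc N Λ K s j i G) (h' : IsCollarDisc N Λ K s' j i' G') (hK : K ≤ Λ) (hΛ : 0 < Λ)
    (hN : IsTopologicalNeck N (-(4 * Λ)) (4 * Λ)) {v w : Euc n} (hv : v ≠ 0) (hw : w ≠ 0)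
    (heq : polarNeck N s G v = polarNeck N s' G' w) :
    ‖v‖⁻¹ • v = ‖w‖⁻¹ • w ∧ s * G ‖v‖ = s' * G' ‖w‖ := by
  have h1 : G ‖v‖ ∈ Ioo (-(4 * Λ)) (K / 2) := h.image ▸ mem_image_of_mem G (norm_pos_iff.mpr hv)
  have h2 : G' ‖w‖ ∈ Ioo (-(4 * Λ)) (K / 2) := h'.image ▸ mem_image_of_mem G' (norm_pos_iff.mpr hw)
  refine hN.injective _ _ (norm_smul_inv_norm hv) (norm_smul_inv_norm hw) _ ?_ _ ?_ heq
  · rcases hs with rfl | rfl <;> constructor <;> linarith [h1.1, h1.2]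
  · rcases hs' with rfl | rfl <;> constructor <;> linarith [h2.1, h2.2]

theorem IsCollarDisc.injOn_polarNeck {N : Euc n → ℝ → M} {Λ K s : ℝ} (hs : s = 1 ∨ s = -1)
    {j : M → M'} {i : Euc n → M'} {G : ℝ → ℝ}
    (h : IsCollarDisc N Λ K s j i G) (hK : K ≤ Λ) (hΛ : 0 < Λ)
    (hN : IsTopologicalNeck N (-(4 * Λ)) (4 * Λ)) : InjOn (polarNeck N s G) {0}ᶜ := by
  intro v hv w hw heq
  have h1 := h.polarNeck_eq hs hs h hK hΛ hN hv hw heq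
  have h2 : G ‖v‖ = G ‖w‖ := by
    rcases hs with rfl | rfl <;> linarith [h1.2]
  have h3 : ‖v‖ = ‖w‖ := (strictAntiOn_of_contDiffOn_of_deriv_neg h.smooth h.deriv_neg).injOn
    (norm_pos_iff.mpr hv) (norm_pos_iff.mpr hw) h2
  rw [← norm_smul_inv_smul hv, h1.1, h3, norm_smul_inv_smul hw]

/-- A common point has axial coordinate z < K/2 from the first disc and z > -K/2 from the second.
This puts both radii below 1, in the linear range of the profiles, where K(1/2 - |v|) = -K(1/2 -
|w|) means |v| + |w| = 1. -/
theorem glued_of_polarNeck_eq {N : Euc n → ℝ → M} {Λ K : ℝ} (hK0 : 0 < K) (hK : K ≤ Λ)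
    (hΛ : 0 < Λ) {j : M → M'} {i₁ i₂ : Euc n → M'} {G₁ G₂ : ℝ → ℝ}
    (h₁ : IsCollarDisc N Λ K 1 j i₁ G₁) (h₂ : IsCollarDisc N Λ K (-1) j i₂ G₂)
    (hN : IsTopologicalNeck N (-(4 * Λ)) (4 * Λ)) {v w : Euc n} (hv : v ≠ 0) (hw : w ≠ 0)
    (heq : polarNeck N 1 G₁ v = polarNeck N (-1) G₂ w) : Glued i₁ i₂ (i₁ v) (i₂ w) := by
  obtain ⟨he, hG⟩ := h₁.polarNeck_eq (Or.inl rfl) (Or.inr rfl) h₂ hK hΛ hN hv hw heq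
  have hv' := norm_pos_iff.mpr hv
  have hw' := norm_pos_iff.mpr hw
  have lt_one : ∀ {s : ℝ} {i : Euc n → M'} {G : ℝ → ℝ}, IsCollarDisc N Λ K s j i G → ∀ {t : ℝ},
      0 < t → -(K / 2) < G t → t < 1 := by
    intro s i G h t ht hlt
    by_contra hcon
    have := (strictAntiOn_of_contDiffOn_of_deriv_neg h.smooth h.deriv_neg).antitoneOn
      (by norm_num : (1 : ℝ) ∈ Ioi 0) ht (not_lt.mp hcon)
    rw [h.eq_linear 1 (by norm_num)] at this
    linarith
  have m₁ : G₁ ‖v‖ ∈ Ioo (-(4 * Λ)) (K / 2) := h₁.image ▸ mem_image_of_mem G₁ hv'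
  have m₂ : G₂ ‖w‖ ∈ Ioo (-(4 * Λ)) (K / 2) := h₂.image ▸ mem_image_of_mem G₂ hw'
  have hv1 : ‖v‖ < 1 := lt_one h₁ hv' (by linarith [m₂.2])
  have hw1 : ‖w‖ < 1 := lt_one h₂ hw' (by linarith [m₁.2])
  rw [h₁.eq_linear _ (by linarith), h₂.eq_linear _ (by linarith)] at hG
  have hsum : ‖w‖ = 1 - ‖v‖ := by
    have : K * (1 - ‖v‖ - ‖w‖) = 0 := by linarith
    rcases mul_eq_zero.mp this with h | h <;> linarith
  refine ⟨‖v‖⁻¹ • v, norm_smul_inv_norm hv, ‖v‖, ⟨hv', hv1⟩, ?_, ?_⟩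
  · rw [norm_smul_inv_smul hv]
  · rw [he, ← hsum, norm_smul_inv_smul hw]

/-- The map is the inverse of `j` on the unchanged part and the polar neck on each disc. These
prescriptions agree on overlaps because the discs are attached along the neck. Points of different
pieces with the same image coincide on a collar, unless they lie in different discs, where they are
glued. -/
theorem exists_isSelfGluing [T2Space M] [Nonempty M] [IsManifold (𝓡 n) ∞ M] {N : Euc n → ℝ → M}
    {Λ K : ℝ} (hK0 : 0 < K) (hK : K ≤ Λ) (hN : IsTopologicalNeck N (-(4 * Λ)) (4 * Λ))
    {j : M → M'} {i₁ i₂ : Euc n → M'} {G₁ G₂ : ℝ → ℝ} (hd : Disjoint (range i₁) (range i₂))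
    (hj : IsLocalDiffeomorphOn (𝓡 n) (𝓡 n) ∞ j (core N Λ)ᶜ) (hj' : InjOn j (core N Λ)ᶜ)
    (h₁ : IsCollarDisc N Λ K 1 j i₁ G₁) (h₂ : IsCollarDisc N Λ K (-1) j i₂ G₂)
    (hun : j '' (core N Λ)ᶜ ∪ range i₁ ∪ range i₂ = univ) :
    ∃ f : M' → M, IsSelfGluing i₁ i₂ f := by
  have hΛ : 0 < Λ := hK0.trans_le hK
  have s1 : (1 : ℝ) = 1 ∨ (1 : ℝ) = -1 := Or.inl rfl
  have s2 : (-1 : ℝ) = 1 ∨ (-1 : ℝ) = -1 := Or.inr rfl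
  have hne : ∀ v w, i₁ v ≠ i₂ w := fun v w h =>
    disjoint_left.mp hd (mem_range_self v) (h ▸ mem_range_self w)
  have hex : ∀ y : M', ∃ z : M, (∀ x ∉ core N Λ, j x = y → z = x) ∧
      (∀ v ≠ 0, i₁ v = y → z = polarNeck N 1 G₁ v) ∧
      (∀ v ≠ 0, i₂ v = y → z = polarNeck N (-1) G₂ v) := by
    intro y
    by_cases hy : ∃ x ∉ core N Λ, j x = y
    · obtain ⟨x, hx, rfl⟩ := hy
      exact ⟨x, fun x' hx' h => hj' hx hx' h.symm, fun v _ h => (h₁.of_mem x hx v h.symm).2,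
        fun v _ h => (h₂.of_mem x hx v h.symm).2⟩
    by_cases hy1 : ∃ v, i₁ v = y
    · obtain ⟨v, rfl⟩ := hy1
      refine ⟨polarNeck N 1 G₁ v, fun x hx h => (hy ⟨x, hx, h⟩).elim, fun w _ h => ?_,
        fun w _ h => (hne v w h.symm).elim⟩
      rw [h₁.isDisc.2 h]
    by_cases hy2 : ∃ v, i₂ v = y
    · obtain ⟨v, rfl⟩ := hy2
      refine ⟨polarNeck N (-1) G₂ v, fun x hx h => (hy ⟨x, hx, h⟩).elim,
        fun w _ h => (hne w v h).elim, fun w _ h => ?_⟩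
      rw [h₂.isDisc.2 h]
    -- No point falls under this case, by `hun`; any value will do. The values at the two centres
    -- are likewise immaterial.
    · exact ⟨Classical.arbitrary M, fun x hx h => (hy ⟨x, hx, h⟩).elim,
        fun v _ h => (hy1 ⟨v, h⟩).elim, fun v _ h => (hy2 ⟨v, h⟩).elim⟩
  choose f hfj hf1 hf2 using hex
  replace hfj : ∀ x ∉ core N Λ, f (j x) = x := fun x hx => hfj _ x hx rfl
  replace hf1 : ∀ v ≠ 0, f (i₁ v) = polarNeck N 1 G₁ v := fun v hv => hf1 _ v hv rfl
  replace hf2 : ∀ v ≠ 0, f (i₂ v) = polarNeck N (-1) G₂ v := fun v hv => hf2 _ v hv rfl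
  have hcases : ∀ y ∈ ({i₁ 0, i₂ 0}ᶜ : Set M'), (∃ x ∉ core N Λ, y = j x) ∨
      (∃ v ≠ 0, y = i₁ v) ∨ (∃ v ≠ 0, y = i₂ v) := by
    intro y hy
    have hy' : y ≠ i₁ 0 ∧ y ≠ i₂ 0 := by simpa [not_or] using hy
    have : y ∈ j '' (core N Λ)ᶜ ∪ range i₁ ∪ range i₂ := hun ▸ mem_univ y
    rcases this with (⟨x, hx, rfl⟩ | ⟨v, rfl⟩) | ⟨v, rfl⟩
    · exact Or.inl ⟨x, hx, rfl⟩
    · exact Or.inr (Or.inl ⟨v, fun h => hy'.1 (by rw [h]), rfl⟩)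
    · exact Or.inr (Or.inr ⟨v, fun h => hy'.2 (by rw [h]), rfl⟩)
  have hmem1 : ∀ v ≠ 0, i₁ v ∈ ({i₁ 0, i₂ 0}ᶜ : Set M') := fun v hv h => by
    rcases h with h | h
    · exact hv (h₁.isDisc.2 h)
    · exact hne _ _ h
  have hmem2 : ∀ v ≠ 0, i₂ v ∈ ({i₁ 0, i₂ 0}ᶜ : Set M') := fun v hv h => by
    rcases h with h | h
    · exact hne _ _ h.symm
    · exact hv (h₂.isDisc.2 h)
  have hmemj : ∀ x ∉ core N Λ, j x ∈ ({i₁ 0, i₂ 0}ᶜ : Set M') := fun x hx h => by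
    rcases h with h | h
    · exact (h₁.of_mem x hx 0 h).1 rfl
    · exact (h₂.of_mem x hx 0 h).1 rfl
  -- The converse of `of_mem`: equal images in the neck outside the core come from a single point of
  -- the collar.
  have hj1 : ∀ x ∉ core N Λ, ∀ v ≠ 0, x = polarNeck N 1 G₁ v → j x = i₁ v := by
    intro x hx v hv h
    rw [h₁.collar v hv, h]
    by_contra hcon
    exact hx (h ▸ polarNeck_mem_core N s1 h₁ hK hΛ hv (not_lt.mp hcon))
  have hj2 : ∀ x ∉ core N Λ, ∀ v ≠ 0, x = polarNeck N (-1) G₂ v → j x = i₂ v := by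
    intro x hx v hv h
    rw [h₂.collar v hv, h]
    by_contra hcon
    exact hx (h ▸ polarNeck_mem_core N s2 h₂ hK hΛ hv (not_lt.mp hcon))
  refine ⟨f, h₁.isDisc, h₂.isDisc, hd, ?_, ?_, ?_⟩
  · rintro ⟨y, hy⟩
    have h0 : ∀ v : Euc n, v ≠ 0 → ∀ᶠ w in 𝓝 v, w ≠ 0 := fun v hv => isOpen_ne.mem_nhds hv
    rcases hcases y hy with ⟨x, hx, rfl⟩ | ⟨v, hv, rfl⟩ | ⟨v, hv, rfl⟩
    · refine isLocalDiffeomorphAt_of_comp_right (h := id)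
        ((Diffeomorph.refl (𝓡 n) M ∞).isLocalDiffeomorph x) (hj ⟨x, hx⟩) ?_
      filter_upwards [(isClosed_core hΛ.le hN).isOpen_compl.mem_nhds hx] with w hw using hfj w hw
    · refine isLocalDiffeomorphAt_of_comp_right (i := i₁)
        (h₁.isLocalDiffeomorphAt_polarNeck s1 hK hΛ hN hv) (h₁.isDisc.1 v) ?_
      filter_upwards [h0 v hv] with w hw using hf1 w hw
    · refine isLocalDiffeomorphAt_of_comp_right (i := i₂)
        (h₂.isLocalDiffeomorphAt_polarNeck s2 hK hΛ hN hv) (h₂.isDisc.1 v) ?_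
      filter_upwards [h0 v hv] with w hw using hf2 w hw
  · refine eq_univ_of_forall fun z => ?_
    by_cases hz : z ∈ core N Λ
    · obtain ⟨ξ, hξ, r, hr, rfl⟩ := hz
      -- The first disc covers z < K/2 and the second z > -K/2, so the two overlapping ranges
      -- exhaust the core.
      rcases lt_or_ge r (K / 2) with hlt | hge
      · obtain ⟨v, hv, hv'⟩ := h₁.exists_polarNeck_eq hξ (z := r) ⟨by linarith [hr.1], hlt⟩
        exact ⟨i₁ v, hmem1 v hv, by rw [hf1 v hv, hv', one_mul]⟩
      · obtain ⟨v, hv, hv'⟩ := h₂.exists_polarNeck_eq hξ (z := -r)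
          ⟨by linarith [hr.2], by linarith⟩
        exact ⟨i₂ v, hmem2 v hv, by rw [hf2 v hv, hv', neg_one_mul, neg_neg]⟩
    · exact ⟨j z, hmemj z hz, hfj z hz⟩
  · have hback : ∀ x y, Glued i₁ i₂ x y → f x = f y := by
      rintro _ _ ⟨ξ, hξ, t, ht, rfl, rfl⟩
      have hξ0 : ξ ≠ 0 := norm_ne_zero_iff.mp (by rw [hξ]; norm_num)
      have ht' : 0 < 1 - t := by linarith [ht.2]
      rw [hf1 _ (smul_ne_zero ht.1.ne' hξ0), hf2 _ (smul_ne_zero ht'.ne' hξ0),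
        polarNeck_smul N 1 G₁ hξ ht.1, polarNeck_smul N (-1) G₂ hξ ht',
        h₁.eq_linear t (by linarith [ht.2]), h₂.eq_linear (1 - t) (by linarith [ht.1])]
      congr 1
      ring
    intro x hx y hy
    constructor
    · intro h
      rcases hcases x hx with ⟨a, ha, rfl⟩ | ⟨v, hv, rfl⟩ | ⟨v, hv, rfl⟩ <;>
      rcases hcases y hy with ⟨b, hb, rfl⟩ | ⟨w, hw, rfl⟩ | ⟨w, hw, rfl⟩
      · rw [hfj a ha, hfj b hb] at h
        exact Or.inl (by rw [h])
      · rw [hfj a ha, hf1 w hw] at h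
        exact Or.inl (hj1 a ha w hw h)
      · rw [hfj a ha, hf2 w hw] at h
        exact Or.inl (hj2 a ha w hw h)
      · rw [hfj b hb, hf1 v hv] at h
        exact Or.inl (hj1 b hb v hv h.symm).symm
      · rw [hf1 v hv, hf1 w hw] at h
        exact Or.inl (by rw [h₁.injOn_polarNeck s1 hK hΛ hN hv hw h])
      · rw [hf1 v hv, hf2 w hw] at h
        exact Or.inr (Or.inl (glued_of_polarNeck_eq hK0 hK hΛ h₁ h₂ hN hv hw h))
      · rw [hfj b hb, hf2 v hv] at h
        exact Or.inl (hj2 b hb v hv h.symm).symm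
      · rw [hf1 w hw, hf2 v hv] at h
        exact Or.inr (Or.inr (glued_of_polarNeck_eq hK0 hK hΛ h₁ h₂ hN hw hv h.symm))
      · rw [hf2 v hv, hf2 w hw] at h
        exact Or.inl (by rw [h₂.injOn_polarNeck s2 hK hΛ hN hv hw h])
    · rintro (rfl | h | h)
      · rfl
      · exact hback _ _ h
      · exact (hback _ _ h).symm

theorem IsStandardSurgery.exists_isSelfGluing [T2Space M] [Nonempty M] [IsManifold (𝓡 n) ∞ M]
    {F : M → Euc d} {N : Euc n → ℝ → M} {Λ τ B : ℝ} {F' : M' → Euc d} (hΛ : 0 < Λ)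
    (hN : IsTopologicalNeck N (-(4 * Λ)) (4 * Λ)) (h : IsStandardSurgery F N Λ τ B F') :
    ∃ (i₁ i₂ : Euc n → M') (f : M' → M), IsSelfGluing i₁ i₂ f := by
  obtain ⟨φ, Q, j, c₁, c₂, -, -, hj, hj', -, h₁, h₂, hd, hun⟩ := h
  obtain ⟨i₁, K₁, hK₁, -, hr₁, hG₁⟩ := h₁.exists_isCollarDisc hΛ
  obtain ⟨i₂, K₂, hK₂, -, hr₂, hG₂⟩ := h₂.exists_isCollarDisc hΛ
  -- One slope that is admissible for both discs.
  have hK : 0 < min Λ (min K₁ K₂) := lt_min hΛ (lt_min hK₁ hK₂)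
  obtain ⟨G₁, hG₁⟩ := hG₁ _ hK ((min_le_right _ _).trans (min_le_left _ _))
  obtain ⟨G₂, hG₂⟩ := hG₂ _ hK ((min_le_right _ _).trans (min_le_right _ _))
  rw [← hr₁, ← hr₂] at hd hun
  exact ⟨i₁, i₂, NeckSurgery.exists_isSelfGluing hK (min_le_left _ _) hN hd hj hj' hG₁ hG₂ hun⟩

end

/-! ### Components of the manifold after surgery, and connected sums -/

section

open Filter Topology TopologicalSpace

variable {n : ℕ}

theorem glued_swap {M₁ M₂ : Type*} {i₁ : Euc n → M₁} {i₂ : Euc n → M₂} {x : M₁} {y : M₂}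
    (h : Glued i₁ i₂ x y) : Glued i₂ i₁ y x := by
  obtain ⟨ξ, hξ, t, ht, hx, hy⟩ := h
  exact ⟨ξ, hξ, 1 - t, ⟨by linarith [ht.2], by linarith [ht.1]⟩, hy, by rw [sub_sub_cancel, hx]⟩

variable {M M' : Type*} [TopologicalSpace M] [ChartedSpace (Euc n) M]
  [TopologicalSpace M'] [ChartedSpace (Euc n) M'] {i₁ i₂ : Euc n → M'} {f : M' → M}

theorem IsDisc.continuous {i : Euc n → M'} (h : IsDisc i) : Continuous i :=
  h.1.contMDiff.continuous

theorem IsSelfGluing.swap (h : IsSelfGluing i₁ i₂ f) : IsSelfGluing i₂ i₁ f where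
  disc₁ := h.disc₂
  disc₂ := h.disc₁
  disjoint := h.disjoint.symm
  localDiffeo := pair_comm (i₁ 0) (i₂ 0) ▸ h.localDiffeo
  surj := pair_comm (i₁ 0) (i₂ 0) ▸ h.surj
  eq_iff x hx y hy := by
    rw [pair_comm] at hx hy
    rw [h.eq_iff x hx y hy]
    have : ∀ x y, Glued i₁ i₂ x y ↔ Glued i₂ i₁ y x := fun x y => ⟨glued_swap, glued_swap⟩
    rw [this x y, this y x, or_comm (a := Glued i₂ i₁ y x)]

theorem IsSelfGluing.isSelfConnectedSum (h : IsSelfGluing i₁ i₂ f) : IsSelfConnectedSum n M' M :=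
  ⟨i₁, i₂, f, h.disc₁, h.disc₂,
    h.disjoint.mono (image_subset_range _ _) (image_subset_range _ _), h.localDiffeo, h.surj,
    h.eq_iff⟩

theorem Glued.mem_range_left {M₁ M₂ : Type*} {i₁ : Euc n → M₁} {i₂ : Euc n → M₂} {x : M₁} {y : M₂}
    (h : Glued i₁ i₂ x y) : x ∈ range i₁ := by
  obtain ⟨ξ, -, t, -, rfl, -⟩ := h
  exact mem_range_self _

theorem Glued.mem_range_right {M₁ M₂ : Type*} {i₁ : Euc n → M₁} {i₂ : Euc n → M₂} {x : M₁} {y : M₂}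
    (h : Glued i₁ i₂ x y) : y ∈ range i₂ := by
  obtain ⟨ξ, -, t, -, -, rfl⟩ := h
  exact mem_range_self _

/-- When the connected sum is connected, every component meets one of the two discs. -/
theorem IsSelfGluing.range_subset_of_isClopen [CompactSpace M'] [T2Space M] [ConnectedSpace M]
    (hn : 0 < n) (h : IsSelfGluing i₁ i₂ f) {U : Set M'} (hU : IsClopen U) (hne : U.Nonempty) :
    range i₁ ⊆ U ∨ range i₂ ⊆ U := by
  by_contra hcon
  rw [not_or] at hcon
  have key : ∀ i : Euc n → M', IsDisc i → ¬ range i ⊆ U → ∀ x ∈ U, x ∉ range i := by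
    intro i hi hr x hx hxr
    exact hr ((isPreconnected_range hi.continuous).subset_isClopen hU ⟨x, hxr, hx⟩)
  have k₁ := key i₁ h.disc₁ hcon.1
  have k₂ := key i₂ h.disc₂ hcon.2
  have hsub : U ⊆ {i₁ 0, i₂ 0}ᶜ := by
    intro x hx hx'
    rcases hx' with hx' | hx'
    · exact k₁ x hx ⟨0, hx'.symm⟩
    · exact k₂ x hx ⟨0, hx'.symm⟩
  have hopen : IsOpen (f '' U) := isOpen_image_of_isLocalDiffeomorphOn h.localDiffeo hU.isOpen hsub
  have hclosed : IsClosed (f '' U) :=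
    (hU.isClosed.isCompact.image_of_continuousOn
      (h.localDiffeo.contMDiffOn.continuousOn.mono hsub)).isClosed
  have huniv : f '' U = univ := IsClopen.eq_univ ⟨hclosed, hopen⟩ (hne.image f)
  -- Since the image of `U` is everything, it contains the image of a noncentral point of the first
  -- disc. By `eq_iff` some point of `U` would then lie in one of the discs, which `U` avoids.
  have : Nontrivial (Euc n) := by
    have : Nonempty (Fin n) := ⟨⟨0, hn⟩⟩
    infer_instance
  obtain ⟨v, hv⟩ := exists_ne (0 : Euc n)
  obtain ⟨u, hu, huv⟩ : f (i₁ v) ∈ f '' U := huniv ▸ mem_univ _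
  have hvmem : i₁ v ∈ ({i₁ 0, i₂ 0}ᶜ : Set M') := by
    rintro (hx' | hx')
    · exact hv (h.disc₁.2 hx')
    · exact disjoint_left.mp h.disjoint (mem_range_self v) (hx' ▸ mem_range_self 0)
  rcases (h.eq_iff u (hsub hu) _ hvmem).mp huv with he | he | he
  · exact k₁ u hu ⟨v, he.symm⟩
  · exact k₁ u hu he.mem_range_left
  · exact k₂ u hu he.mem_range_right

/-- The components are those of the two disc centres. The complement of their union is clopen and
contains neither disc, hence is empty; and if they coincided, `M'` would be connected. -/
theorem IsSelfGluing.exists_two_components [CompactSpace M'] [T2Space M] [ConnectedSpace M]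
    (hn : 0 < n) (h : IsSelfGluing i₁ i₂ f) (hM' : ¬ ConnectedSpace M') :
    ∃ M₁ M₂ : Opens M', ConnectedSpace M₁ ∧ ConnectedSpace M₂ ∧ IsCompl M₁ M₂ := by
  have : LocallyConnectedSpace M' := ChartedSpace.locallyConnectedSpace (Euc n) M'
  let C : M' → Opens M' := fun x => ⟨connectedComponent x, isOpen_connectedComponent⟩
  have hC : ∀ x, ConnectedSpace (C x) := fun x =>
    isConnected_iff_connectedSpace.mp isConnected_connectedComponent
  have hr : ∀ i : Euc n → M', IsDisc i → range i ⊆ connectedComponent (i 0) := fun i hi =>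
    (isPreconnected_range hi.continuous).subset_connectedComponent (mem_range_self 0)
  have hun : connectedComponent (i₁ 0) ∪ connectedComponent (i₂ 0) = univ := by
    by_contra hcon
    have hcl : IsClopen (connectedComponent (i₁ 0) ∪ connectedComponent (i₂ 0))ᶜ :=
      (isClopen_connectedComponent.union isClopen_connectedComponent).compl
    rcases h.range_subset_of_isClopen hn hcl (nonempty_compl.mpr hcon) with hs | hs
    · exact hs (mem_range_self 0) (Or.inl mem_connectedComponent)
    · exact hs (mem_range_self 0) (Or.inr mem_connectedComponent)
  have hne : connectedComponent (i₁ 0) ≠ connectedComponent (i₂ 0) := by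
    intro heq
    rw [← heq, union_self] at hun
    exact hM' (connectedSpace_iff_univ.mpr (hun ▸ isConnected_connectedComponent))
  refine ⟨C (i₁ 0), C (i₂ 0), hC _, hC _, IsCompl.of_eq ?_ ?_⟩
  · exact Opens.ext (disjoint_iff_inter_eq_empty.mp (connectedComponent_disjoint hne))
  · exact Opens.ext hun

theorem isDisc_codRestrict {i : Euc n → M'} (hi : IsDisc i) {U : Opens M'}
    (hU : ∀ v, i v ∈ U) : IsDisc (fun v => (⟨i v, hU v⟩ : U)) := by
  refine ⟨fun v => ?_, fun v w h => hi.2 (congrArg Subtype.val h)⟩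
  exact isLocalDiffeomorphAt_of_comp_left (hi.1 v) (isLocalDiffeomorphAt_subtype_val U _)
    (hi.continuous.subtype_mk hU).continuousAt Filter.EventuallyEq.rfl

/-- Restrict the gluing map to the two pieces. Glued points lie in different pieces, so each
restriction is injective off its centre, and across the pieces only the identification of the discs
survives. -/
theorem IsSelfGluing.isConnectedSum (h : IsSelfGluing i₁ i₂ f) {M₁ M₂ : Opens M'}
    (hM : IsCompl M₁ M₂) (h₁ : range i₁ ⊆ M₁) (h₂ : range i₂ ⊆ M₂) :
    IsConnectedSum n M₁ M₂ M := by
  have hd : ∀ x, x ∈ M₁ → x ∉ M₂ := fun x hx hx' =>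
    (disjoint_iff_inf_le.mp hM.disjoint : M₁ ⊓ M₂ ≤ ⊥) ⟨hx, hx'⟩
  have hun : ∀ x, x ∈ M₁ ∨ x ∈ M₂ := fun x =>
    (codisjoint_iff_le_sup.mp hM.codisjoint : ⊤ ≤ M₁ ⊔ M₂) (mem_univ x)
  have m₁ : ∀ v, i₁ v ∈ M₁ := fun v => h₁ (mem_range_self v)
  have m₂ : ∀ v, i₂ v ∈ M₂ := fun v => h₂ (mem_range_self v)
  have c₁ : ∀ x : M₁, x ∈ ({⟨i₁ 0, m₁ 0⟩}ᶜ : Set M₁) → (x : M') ∈ ({i₁ 0, i₂ 0}ᶜ : Set M') := by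
    rintro x hx (hx' | hx')
    · exact hx (Subtype.ext hx')
    · exact hd x x.2 (hx' ▸ m₂ 0)
  have c₂ : ∀ x : M₂, x ∈ ({⟨i₂ 0, m₂ 0⟩}ᶜ : Set M₂) → (x : M') ∈ ({i₁ 0, i₂ 0}ᶜ : Set M') := by
    rintro x hx (hx' | hx')
    · exact hd x (hx' ▸ m₁ 0) x.2
    · exact hx (Subtype.ext hx')
  refine ⟨fun v => ⟨i₁ v, m₁ v⟩, fun v => ⟨i₂ v, m₂ v⟩, fun x => f x, fun x => f x,
    isDisc_codRestrict h.disc₁ m₁, isDisc_codRestrict h.disc₂ m₂, ?_, ?_, ?_, ?_, ?_, ?_⟩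
  · rintro ⟨x, hx⟩
    exact (isLocalDiffeomorphAt_subtype_val M₁ x).comp _ _ (h.localDiffeo ⟨x, c₁ x hx⟩)
  · intro x hx y hy hxy
    rcases (h.eq_iff x (c₁ x hx) y (c₁ y hy)).mp hxy with he | he | he
    · exact Subtype.ext he
    · exact (hd _ y.2 (h₂ he.mem_range_right)).elim
    · exact (hd _ x.2 (h₂ he.mem_range_right)).elim
  · rintro ⟨x, hx⟩
    exact (isLocalDiffeomorphAt_subtype_val M₂ x).comp _ _ (h.localDiffeo ⟨x, c₂ x hx⟩)
  · intro x hx y hy hxy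
    rcases (h.eq_iff x (c₂ x hx) y (c₂ y hy)).mp hxy with he | he | he
    · exact Subtype.ext he
    · exact (hd _ (h₁ he.mem_range_left) x.2).elim
    · exact (hd _ (h₁ he.mem_range_left) y.2).elim
  · refine eq_univ_of_forall fun z => ?_
    obtain ⟨x, hx, rfl⟩ : z ∈ f '' {i₁ 0, i₂ 0}ᶜ := h.surj ▸ mem_univ z
    rcases hun x with hx' | hx'
    · exact Or.inl ⟨⟨x, hx'⟩, fun he => hx (Or.inl (congrArg Subtype.val he)), rfl⟩
    · exact Or.inr ⟨⟨x, hx'⟩, fun he => hx (Or.inr (congrArg Subtype.val he)), rfl⟩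
  · intro x hx y hy
    rw [h.eq_iff x (c₁ x hx) y (c₂ y hy)]
    constructor
    · rintro (he | he | he)
      · exact (hd _ x.2 (he ▸ y.2)).elim
      · obtain ⟨ξ, hξ, t, ht, hx', hy'⟩ := he
        exact ⟨ξ, hξ, t, ht, Subtype.ext hx', Subtype.ext hy'⟩
      · exact (hd _ (h₁ he.mem_range_left) y.2).elim
    · rintro ⟨ξ, hξ, t, ht, rfl, rfl⟩
      exact Or.inr (Or.inl ⟨ξ, hξ, t, ht, rfl, rfl⟩)

/-- Each piece is clopen and nonempty, so it contains a disc, and no disc lies in both. Which disc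
lies where is not known in advance; `swap` covers the second possibility. -/
theorem IsSelfGluing.isConnectedSum_of_isCompl [CompactSpace M'] [T2Space M] [ConnectedSpace M]
    (hn : 0 < n) (h : IsSelfGluing i₁ i₂ f) {M₁ M₂ : Opens M'} (h₁ : Nonempty M₁)
    (h₂ : Nonempty M₂) (hM : IsCompl M₁ M₂) : IsConnectedSum n M₁ M₂ M := by
  have hcompl : (M₁ : Set M')ᶜ = M₂ := by
    have hd : (M₁ : Set M') ⊓ M₂ = ⊥ := congrArg ((↑) : Opens M' → Set M') hM.inf_eq_bot
    have hu : (M₁ : Set M') ⊔ M₂ = ⊤ := congrArg ((↑) : Opens M' → Set M') hM.sup_eq_top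
    exact (IsCompl.of_eq hd hu).compl_eq
  have hc₁ : IsClopen (M₁ : Set M') := ⟨⟨hcompl ▸ M₂.isOpen⟩, M₁.isOpen⟩
  have hc₂ : IsClopen (M₂ : Set M') := hcompl ▸ hc₁.compl
  have hnot : ∀ i : Euc n → M', range i ⊆ M₁ → range i ⊆ M₂ → False := fun i hi hi' => by
    rw [← hcompl] at hi'
    exact hi' (mem_range_self 0) (hi (mem_range_self 0))
  rcases h.range_subset_of_isClopen hn hc₁ (nonempty_subtype.mp h₁) with a | a <;>
  rcases h.range_subset_of_isClopen hn hc₂ (nonempty_subtype.mp h₂) with b | b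
  · exact (hnot _ a b).elim
  · exact h.isConnectedSum hM a b
  · exact h.swap.isConnectedSum hM a b
  · exact (hnot _ a b).elim

end

/-! ### Extension of germs of diffeomorphisms -/

section

open Filter Topology

variable {n : ℕ}

theorem isLocalDiffeomorphAt_of_fderiv_injective {f : Euc n → Euc n} {U : Set (Euc n)}
    (hU : IsOpen U) (hf : ContDiffOn ℝ ∞ f U) {a : Euc n} (ha : a ∈ U)
    (h : ∀ v, fderiv ℝ f a v = 0 → v = 0) : IsLocalDiffeomorphAt (𝓡 n) (𝓡 n) ∞ f a := by
  let L : Euc n ≃L[ℝ] Euc n :=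
    (LinearEquiv.ofInjectiveEndo (fderiv ℝ f a : Euc n →ₗ[ℝ] Euc n)
      ((injective_iff_map_eq_zero _).mpr h)).toContinuousLinearEquiv
  have hL : (L : Euc n →L[ℝ] Euc n) = fderiv ℝ f a := by ext; rfl
  refine isLocalDiffeomorphAt_of_hasFDerivAt hU hf ha L ?_
  rw [hL]
  exact ((hf.contDiffAt (hU.mem_nhds ha)).differentiableAt (by simp)).hasFDerivAt

/-- Every germ at the origin of a diffeomorphism with differential the identity is the germ of a
diffeomorphism of `ℝⁿ` which is the identity far from the origin. -/
theorem exists_extension_of_germ (hn : 0 < n) {g : Euc n → Euc n} {U : Set (Euc n)}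
    (hU : IsOpen U) (hU0 : 0 ∈ U) (hg : ContDiffOn ℝ ∞ g U) (hg0 : g 0 = 0)
    (hg' : HasFDerivAt g (ContinuousLinearMap.id ℝ (Euc n)) 0) :
    ∃ K : Euc n → Euc n, Function.Bijective K ∧ IsLocalDiffeomorph (𝓡 n) (𝓡 n) ∞ K ∧
      K =ᶠ[𝓝 0] g ∧ ∃ R > 0, ∀ y, R ≤ ‖y‖ → K y = y := by
  have : Nontrivial (Euc n) := by
    have : Nonempty (Fin n) := ⟨⟨0, hn⟩⟩
    infer_instance
  let b : ContDiffBump (0 : Euc n) := ⟨1, 2, by norm_num, by norm_num⟩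
  obtain ⟨C, hC⟩ : ∃ C, LipschitzWith C b :=
    ContDiff.lipschitzWith_of_hasCompactSupport b.hasCompactSupport (b.contDiff (n := 1)) (by simp)
  -- On the ball of radius 2r, h = g - id has Lipschitz constant ε and norm at most 2rε, while the
  -- rescaled bump has Lipschitz constant C/r. Their product then has constant ε + 2Cε = 1/2,
  -- whatever r is.
  set ε : ℝ := 1 / (2 * (1 + 2 * C)) with hε
  have hε0 : 0 < ε := by positivity
  set h : Euc n → Euc n := fun y => g y - y with hh
  have hhs : ContDiffOn ℝ ∞ h U := hg.sub contDiffOn_id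
  have hh0 : h 0 = 0 := by simp [h, hg0]
  have hh' : fderiv ℝ h 0 = 0 := by
    have : HasFDerivAt h _ 0 := hg'.sub (hasFDerivAt_id 0)
    rw [this.fderiv, sub_self]
  obtain ⟨r, hr, hrU⟩ : ∃ r > 0, ∀ y : Euc n, ‖y‖ ≤ 2 * r → y ∈ U ∧ ‖fderiv ℝ h y‖ ≤ ε := by
    have hc : ContinuousAt (fderiv ℝ h) 0 :=
      (hhs.continuousOn_fderiv_of_isOpen hU (by simp)).continuousAt (hU.mem_nhds hU0)
    have h1 : ∀ᶠ y in 𝓝 (0 : Euc n), y ∈ U ∧ ‖fderiv ℝ h y‖ < ε := by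
      refine (hU.eventually_mem hU0).and (hc.norm.eventually_lt continuousAt_const ?_)
      simpa [hh'] using hε0
    obtain ⟨δ, hδ, hδU⟩ := Metric.eventually_nhds_iff_ball.mp h1
    refine ⟨δ / 4, by positivity, fun y hy => ?_⟩
    have := hδU y (by rw [mem_ball_zero_iff]; linarith)
    exact ⟨this.1, this.2.le⟩
  have hlip : ∀ x y : Euc n, ‖x‖ ≤ 2 * r → ‖y‖ ≤ 2 * r → ‖h x - h y‖ ≤ ε * ‖x - y‖ := by
    intro x y hx hy
    refine (convex_closedBall (0 : Euc n) (2 * r)).norm_image_sub_le_of_norm_fderiv_le (𝕜 := ℝ)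
      (fun z hz => ?_) (fun z hz => ?_) (by simpa using hy) (by simpa using hx)
    · exact (hhs.contDiffAt (hU.mem_nhds (hrU z (by simpa using hz)).1)).differentiableAt (by simp)
    · exact (hrU z (by simpa using hz)).2
  set χ : Euc n → ℝ := fun y => b (r⁻¹ • y) with hχ
  have hχl : ∀ x y, |χ x - χ y| ≤ C * (r⁻¹ * ‖x - y‖) := by
    intro x y
    have := hC.dist_le_mul (r⁻¹ • x) (r⁻¹ • y)
    rwa [Real.dist_eq, dist_eq_norm, ← smul_sub, norm_smul, Real.norm_of_nonneg (by positivity)]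
      at this
  have hχ0 : ∀ y, 2 * r ≤ ‖y‖ → χ y = 0 := by
    intro y hy
    refine b.zero_of_le_dist ?_
    rw [dist_zero_right, norm_smul, Real.norm_of_nonneg (by positivity)]
    change 2 ≤ r⁻¹ * ‖y‖
    rw [inv_mul_eq_div, le_div_iff₀ hr]
    exact hy
  have hχ1 : ∀ y, ‖y‖ ≤ r → χ y = 1 := by
    intro y hy
    refine b.one_of_mem_closedBall ?_
    rw [mem_closedBall_zero_iff, norm_smul, Real.norm_of_nonneg (by positivity)]
    change r⁻¹ * ‖y‖ ≤ 1
    rw [inv_mul_eq_div, div_le_one hr]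
    exact hy
  have hχs : ContDiff ℝ ∞ χ := b.contDiff.comp (contDiff_const_smul r⁻¹)
  set φ : Euc n → Euc n := fun y => χ y • h y with hφ
  have hφl : ∀ x y, ‖φ x - φ y‖ ≤ 1 / 2 * ‖x - y‖ := by
    have hsum : ε + C * (2 * ε) = 1 / 2 := by
      rw [hε]; field_simp
    have hnorm : ∀ y : Euc n, ‖y‖ ≤ 2 * r → ‖h y‖ ≤ ε * (2 * r) := by
      intro y hy
      have := hlip y 0 hy (by simpa using hr.le)
      rw [hh0, sub_zero, sub_zero] at this
      exact this.trans (by gcongr)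
    have hsecond : ∀ x y : Euc n, ‖y‖ ≤ 2 * r →
        ‖(χ x - χ y) • h y‖ ≤ C * (2 * ε) * ‖x - y‖ := by
      intro x y hy
      rw [norm_smul, Real.norm_eq_abs]
      calc |χ x - χ y| * ‖h y‖ ≤ (C * (r⁻¹ * ‖x - y‖)) * (ε * (2 * r)) :=
            mul_le_mul (hχl x y) (hnorm y hy) (norm_nonneg _) (by positivity)
        _ = C * (2 * ε) * ‖x - y‖ := by field_simp
    intro x y
    rcases le_or_gt ‖y‖ (2 * r) with hy | hy
    · rcases le_or_gt ‖x‖ (2 * r) with hx | hx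
      · have h1 : φ x - φ y = χ x • (h x - h y) + (χ x - χ y) • h y := by
          simp only [φ, smul_sub, sub_smul]; abel
        have h2 : ‖χ x • (h x - h y)‖ ≤ ε * ‖x - y‖ := by
          rw [norm_smul, Real.norm_of_nonneg b.nonneg]
          exact (mul_le_of_le_one_left (norm_nonneg _) b.le_one).trans (hlip x y hx hy)
        rw [h1, ← hsum, add_mul]
        exact (norm_add_le _ _).trans (add_le_add h2 (hsecond x y hy))
      · have h1 : φ x - φ y = (χ x - χ y) • h y := by
          simp [φ, hχ0 x hx.le]
        rw [h1, ← hsum, add_mul]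
        exact (hsecond x y hy).trans (le_add_of_nonneg_left (by positivity))
    · rcases le_or_gt ‖x‖ (2 * r) with hx | hx
      · have h1 : φ x - φ y = -((χ y - χ x) • h x) := by
          simp [φ, hχ0 y hy.le]
        rw [h1, norm_neg, ← hsum, add_mul, norm_sub_rev x y]
        exact (hsecond y x hx).trans (le_add_of_nonneg_left (by positivity))
      · simp only [φ, hχ0 y hy.le, hχ0 x hx.le, zero_smul, sub_zero, norm_zero]
        positivity
  have hφs : ContDiff ℝ ∞ φ := by
    rw [contDiff_iff_contDiffAt]
    intro y
    rcases le_or_gt ‖y‖ (2 * r) with hy | hy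
    · exact hχs.contDiffAt.smul (hhs.contDiffAt (hU.mem_nhds (hrU y hy).1))
    · have : φ =ᶠ[𝓝 y] fun _ => 0 := by
        filter_upwards [(isOpen_lt continuous_const continuous_norm).mem_nhds hy] with z hz
        have hz : 2 * r < ‖z‖ := hz
        simp [φ, hχ0 z hz.le]
      exact contDiffAt_const.congr_of_eventuallyEq this
  -- The identity plus a map with Lipschitz constant 1/2 is bijective, and its differential is
  -- injective because ‖Dφ‖ ≤ 1/2.
  have happrox : ApproximatesLinearOn (fun y => y + φ y)
      ((ContinuousLinearEquiv.refl ℝ (Euc n) : Euc n ≃L[ℝ] Euc n) : Euc n →L[ℝ] Euc n)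
      univ (1 / 2) := by
    intro x _ y _
    have h1 : x + φ x - (y + φ y) -
        ((ContinuousLinearEquiv.refl ℝ (Euc n) : Euc n ≃L[ℝ] Euc n) : Euc n →L[ℝ] Euc n) (x - y)
        = φ x - φ y := by
      simp only [ContinuousLinearEquiv.coe_coe, ContinuousLinearEquiv.refl_apply]; abel
    rw [h1]
    simpa using hφl x y
  have hsmall : Subsingleton (Euc n) ∨ (1 / 2 : NNReal) <
      ‖((ContinuousLinearEquiv.refl ℝ (Euc n)).symm : Euc n →L[ℝ] Euc n)‖₊⁻¹ := by
    right
    have : ‖((ContinuousLinearEquiv.refl ℝ (Euc n)).symm : Euc n →L[ℝ] Euc n)‖₊ = 1 := by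
      apply NNReal.eq
      exact ContinuousLinearMap.norm_id
    rw [this, inv_one]
    exact NNReal.half_lt_self one_ne_zero
  refine ⟨fun y => y + φ y, ⟨injOn_univ.mp (happrox.injOn hsmall), happrox.surjective hsmall⟩, fun y => ?_, ?_,
    2 * r, by positivity, fun y hy => ?_⟩
  · refine isLocalDiffeomorphAt_of_fderiv_injective isOpen_univ (contDiff_id.add hφs).contDiffOn
      (mem_univ y) fun v hv => ?_
    have hd : HasFDerivAt (fun y => y + φ y) _ y :=
      (hasFDerivAt_id y).add (hφs.differentiable (by simp) y).hasFDerivAt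
    replace hv : fderiv ℝ (fun y => y + φ y) y v = 0 := hv
    rw [hd.fderiv] at hv
    have hnorm : ‖fderiv ℝ φ y‖ ≤ (1 / 2 : NNReal) :=
      norm_fderiv_le_of_lipschitz ℝ (LipschitzWith.of_dist_le_mul fun x y => by
        rw [dist_eq_norm, dist_eq_norm]; simpa using hφl x y)
    have h1 : v = -(fderiv ℝ φ y v) := eq_neg_of_add_eq_zero_left hv
    have h2 : ‖v‖ ≤ 1 / 2 * ‖v‖ := by
      have := (fderiv ℝ φ y).le_of_opNorm_le hnorm v
      rw [← norm_neg, ← h1] at this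
      simpa using this
    exact norm_le_zero_iff.mp (by linarith)
  · filter_upwards [Metric.ball_mem_nhds (0 : Euc n) hr] with y hy
    simp [φ, hχ1 y (by simpa using (mem_ball_zero_iff.mp hy).le), h]
  · simp [φ, hχ0 y hy]

end

/-! ### Inversions and diffeomorphisms from the ball to ℝⁿ -/

section

open Filter Topology

variable {n : ℕ}

theorem norm_inv_smul_self {v : Euc n} (hv : v ≠ 0) : ‖‖v‖⁻¹ • v‖ = 1 :=
  norm_smul_inv_norm hv

/-- The inversion in the unit sphere, which fixes the origin by convention. -/
noncomputable def inv (y : Euc n) : Euc n := (‖y‖ ^ 2)⁻¹ • y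

theorem norm_inv (y : Euc n) : ‖inv y‖ = ‖y‖⁻¹ := by
  rcases eq_or_ne y 0 with rfl | hy
  · simp [inv]
  · have := norm_pos_iff.mpr hy
    rw [inv, norm_smul, Real.norm_of_nonneg (by positivity)]
    field_simp

theorem inv_involutive : Function.Involutive (inv : Euc n → Euc n) := by
  intro y
  rcases eq_or_ne y 0 with rfl | hy
  · simp [inv]
  · have := norm_pos_iff.mpr hy
    rw [inv, norm_inv, inv, smul_smul, inv_pow, inv_inv, mul_inv_cancel₀ (by positivity), one_smul]

theorem inv_ne_zero' {y : Euc n} (hy : y ≠ 0) : inv y ≠ 0 := by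
  rw [← norm_pos_iff, norm_inv]
  exact inv_pos.mpr (norm_pos_iff.mpr hy)

theorem contDiffOn_inv : ContDiffOn ℝ ∞ (inv : Euc n → Euc n) {0}ᶜ := by
  refine ContDiffOn.smul (ContDiffOn.inv (contDiff_norm_sq ℝ).contDiffOn fun y hy => ?_)
    contDiffOn_id
  exact pow_ne_zero _ (norm_ne_zero_iff.mpr hy)

theorem isLocalDiffeomorphAt_inv {y : Euc n} (hy : y ≠ 0) :
    IsLocalDiffeomorphAt (𝓡 n) (𝓡 n) ∞ inv y :=
  ⟨{  toFun := inv
      invFun := inv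
      source := {0}ᶜ
      target := {0}ᶜ
      map_source' := fun _ h => inv_ne_zero' h
      map_target' := fun _ h => inv_ne_zero' h
      left_inv' := fun y _ => inv_involutive y
      right_inv' := fun y _ => inv_involutive y
      open_source := isOpen_compl_singleton
      open_target := isOpen_compl_singleton
      contMDiffOn_toFun := contDiffOn_inv.contMDiffOn
      contMDiffOn_invFun := contDiffOn_inv.contMDiffOn }, hy, fun _ _ => rfl⟩

/-- The conjugate by the inversion of a diffeomorphism which is the identity near infinity. -/
theorem isLocalDiffeomorph_inv_conj {K : Euc n → Euc n} (hK : Function.Injective K)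
    (hKd : IsLocalDiffeomorph (𝓡 n) (𝓡 n) ∞ K) (hK0 : K 0 = 0) {R : ℝ} (hR : 0 < R)
    (hKR : ∀ y, R ≤ ‖y‖ → K y = y) :
    IsLocalDiffeomorph (𝓡 n) (𝓡 n) ∞ (inv ∘ K ∘ inv) := by
  intro y
  rcases eq_or_ne y 0 with rfl | hy
  · refine isLocalDiffeomorphAt_congr ((Diffeomorph.refl (𝓡 n) (Euc n) ∞).isLocalDiffeomorph 0) ?_
    filter_upwards [Metric.ball_mem_nhds (0 : Euc n) (inv_pos.mpr hR)] with y hy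
    rcases eq_or_ne y 0 with rfl | hy0
    · simp [inv, hK0]
    -- Near the origin the inversion lands where `K` is the identity, so the conjugate is the
    -- identity there; this gives smoothness at the point where the inversion itself is singular.
    · have h1 : R ≤ ‖inv y‖ := by
        rw [norm_inv, le_inv_comm₀ hR (norm_pos_iff.mpr hy0)]
        exact (mem_ball_zero_iff.mp hy).le
      simp only [Function.comp_apply]
      rw [hKR _ h1, inv_involutive]
      rfl
  · have h1 : K (inv y) ≠ 0 := fun h => inv_ne_zero' hy (hK (h.trans hK0.symm))
    exact ((isLocalDiffeomorphAt_inv hy).comp _ _ (hKd (inv y))).comp _ _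
      (isLocalDiffeomorphAt_inv h1)

/-- The radial function of `exists_radial_diffeo` along a ray: it is `c s` near zero and
`(a (1 - s))⁻¹` near one. -/
noncomputable def rayProfile (c a s : ℝ) : ℝ :=
  (1 - Real.smoothTransition (4 * s - 1)) * (c * s) +
    Real.smoothTransition (4 * s - 1) * (a * (1 - s))⁻¹

theorem rayProfile_of_le {c a s : ℝ} (hs : s ≤ 1 / 4) : rayProfile c a s = c * s := by
  rw [rayProfile, Real.smoothTransition.zero_of_nonpos (by linarith)]; ring

theorem rayProfile_of_ge {c a s : ℝ} (hs : 1 / 2 ≤ s) : rayProfile c a s = (a * (1 - s))⁻¹ := by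
  rw [rayProfile, Real.smoothTransition.one_of_one_le (by linarith)]; ring

/-- The condition c a ≤ 1 yields c s ≤ (a(1 - s))⁻¹ on (0, 1), so the transition moves from the
smaller to the larger function and its derivative contributes a nonnegative term. The remainder is a
convex combination of two positive derivatives. -/
theorem exists_hasDerivAt_rayProfile {c a s : ℝ} (hc : 0 < c) (ha : 0 < a) (hca : c * a ≤ 1)
    (hs : s ∈ Ioo (0 : ℝ) 1) : ∃ m > 0, HasDerivAt (rayProfile c a) m s := by
  have h1s : 0 < 1 - s := by linarith [hs.2]
  set η : ℝ → ℝ := fun s => Real.smoothTransition (4 * s - 1) with hη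
  have hηs : ContDiff ℝ ∞ η := Real.smoothTransition.contDiff.comp (by fun_prop)
  have hηm : Monotone η := fun x y hxy => Real.smoothTransition.monotone (by linarith)
  have hd : HasDerivAt η (deriv η s) s := (hηs.differentiable (by simp) s).hasDerivAt
  have hd' : 0 ≤ deriv η s := hηm.deriv_nonneg
  have h1 : HasDerivAt (fun s => c * s) c s := by simpa using (hasDerivAt_id s).const_mul c
  have h2 : HasDerivAt (fun s => (a * (1 - s))⁻¹) (-(a * -1) / (a * (1 - s)) ^ 2) s :=
    (((hasDerivAt_id s).const_sub 1).const_mul a).inv (by positivity)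
  have h3 := ((hd.const_sub 1).mul h1).add (hd.mul h2)
  refine ⟨_, ?_, h3⟩
  have hη0 : 0 ≤ η s := Real.smoothTransition.nonneg _
  have hη1 : η s ≤ 1 := Real.smoothTransition.le_one _
  have hp : 0 < -(a * -1) / (a * (1 - s)) ^ 2 := by
    rw [mul_neg_one, neg_neg]; positivity
  have h4 : c * s ≤ (a * (1 - s))⁻¹ := by
    rw [le_inv_comm₀ (by have := hs.1; positivity) (by positivity)]
    have : c * s * (a * (1 - s)) ≤ 1 := by
      have h5 : s * (1 - s) ≤ 1 := by nlinarith [hs.1, hs.2]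
      have h6 : 0 < s * (1 - s) := mul_pos hs.1 h1s
      nlinarith
    have hcs : 0 < c * s := mul_pos hc hs.1
    rw [← one_div, le_div_iff₀ hcs]
    linarith
  have h7 : 0 < (1 - η s) * c + η s * (-(a * -1) / (a * (1 - s)) ^ 2) := by
    rcases hη0.eq_or_lt with h0 | h0
    · rw [← h0]; simpa using hc
    · have := mul_pos h0 hp
      have := mul_nonneg (sub_nonneg.mpr hη1) hc.le
      linarith
  have h8 := mul_nonneg hd' (sub_nonneg.mpr h4)
  change 0 < -deriv η s * (c * s) + (1 - η s) * c +
    (deriv η s * (a * (1 - s))⁻¹ + η s * (-(a * -1) / (a * (1 - s)) ^ 2))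
  linarith

theorem strictMonoOn_rayProfile {c a : ℝ} (hc : 0 < c) (ha : 0 < a) (hca : c * a ≤ 1) :
    StrictMonoOn (rayProfile c a) (Ioo 0 1) := by
  refine strictMonoOn_of_deriv_pos (convex_Ioo 0 1) (fun s hs => ?_) fun s hs => ?_
  · obtain ⟨m, -, hm⟩ := exists_hasDerivAt_rayProfile hc ha hca hs
    exact hm.continuousAt.continuousWithinAt
  · rw [interior_Ioo] at hs
    obtain ⟨m, hm0, hm⟩ := exists_hasDerivAt_rayProfile hc ha hca hs
    rwa [hm.deriv]

theorem image_rayProfile {c a : ℝ} (hc : 0 < c) (ha : 0 < a) (hca : c * a ≤ 1) :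
    rayProfile c a '' Ioo 0 1 = Ioi 0 := by
  have hm := strictMonoOn_rayProfile hc ha hca
  ext y
  constructor
  · rintro ⟨s, hs, rfl⟩
    have h1 : rayProfile c a (min s (1 / 4)) ≤ rayProfile c a s :=
      hm.monotoneOn ⟨lt_min hs.1 (by norm_num), (min_le_left _ _).trans_lt hs.2⟩ hs
        (min_le_left _ _)
    rw [rayProfile_of_le (min_le_right _ _)] at h1
    exact (mul_pos hc (lt_min hs.1 (by norm_num))).trans_le h1
  · intro hy
    have hy : 0 < y := hy
    set s₀ := min (1 / 4) (y / c) with hs₀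
    have h0 : 0 < s₀ := lt_min (by norm_num) (by positivity)
    have h04 : s₀ ≤ 1 / 4 := min_le_left _ _
    have hr0 : rayProfile c a s₀ ≤ y := by
      rw [rayProfile_of_le h04]
      have := mul_le_mul_of_nonneg_left (min_le_right (1 / 4) (y / c)) hc.le
      rwa [mul_div_cancel₀ _ hc.ne'] at this
    -- At s = 1 - d the profile is (a d)⁻¹, which is at least y.
    set d := min (1 / 2) (a * y)⁻¹ with hd
    have hd0 : 0 < d := lt_min (by norm_num) (by positivity)
    have hd2 : d ≤ 1 / 2 := min_le_left _ _
    have hr1 : y ≤ rayProfile c a (1 - d) := by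
      rw [rayProfile_of_ge (by linarith), sub_sub_cancel, le_inv_comm₀ hy (by positivity)]
      have := mul_le_mul_of_nonneg_left (min_le_right (1 / 2) (a * y)⁻¹) ha.le
      refine this.trans (le_of_eq ?_)
      field_simp
    have hcont : ContinuousOn (rayProfile c a) (Icc s₀ (1 - d)) := fun s hs => by
      obtain ⟨m, -, hm⟩ := exists_hasDerivAt_rayProfile hc ha hca
        (s := s) ⟨h0.trans_le hs.1, by linarith [hs.2]⟩
      exact hm.continuousAt.continuousWithinAt
    obtain ⟨s, hs, rfl⟩ := intermediate_value_Icc (by linarith) hcont ⟨hr0, hr1⟩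
    exact ⟨s, ⟨h0.trans_le hs.1, by linarith [hs.2]⟩, rfl⟩

/-- A diffeomorphism of the open unit ball to `ℝⁿ` which preserves rays and is prescribed near the
unit sphere. -/
theorem exists_radial_diffeo (A : Euc n ≃L[ℝ] Euc n) :
    ∃ R : Euc n → Euc n, BijOn R (Metric.ball 0 1) univ ∧
      IsLocalDiffeomorphOn (𝓡 n) (𝓡 n) ∞ R (Metric.ball 0 1) ∧
      ∀ x, 1 / 2 ≤ ‖x‖ → ‖x‖ < 1 → A (R x) = inv (A (((1 - ‖x‖) / ‖x‖) • x)) := by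
  -- A single constant with c |A ξ|² ≤ 1 for all unit ξ; its independence of the direction makes the
  -- map linear, hence smooth, near the origin.
  set c : ℝ := (‖(A : Euc n →L[ℝ] Euc n)‖ ^ 2 + 1)⁻¹ with hc
  have hc0 : 0 < c := by positivity
  set η : Euc n → ℝ := fun x => Real.smoothTransition (4 * ‖x‖ - 1) with hη
  -- On the ray through a unit vector ξ, x ↦ m(x) x has the radial function `rayProfile c (‖A ξ‖ ^
  -- 2)`. Its outer part is forced: inv(A((1 - s) ξ)) = A(ξ) / ((1 - s) |A ξ|²).
  set m : Euc n → ℝ := fun x => (1 - η x) * c + η x * (‖x‖ / ((1 - ‖x‖) * ‖A x‖ ^ 2)) with hm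
  have hA0 : ∀ x, x ≠ 0 → 0 < ‖A x‖ ^ 2 := fun x hx => by
    have : A x ≠ 0 := fun h => hx (by simpa using h)
    have := norm_pos_iff.mpr this
    positivity
  have hcA : ∀ ξ : Euc n, ‖ξ‖ = 1 → c * ‖A ξ‖ ^ 2 ≤ 1 := by
    intro ξ hξ
    have h1 : ‖A ξ‖ ≤ ‖(A : Euc n →L[ℝ] Euc n)‖ := by
      have := (A : Euc n →L[ℝ] Euc n).le_opNorm ξ
      rwa [hξ, mul_one] at this
    rw [hc, inv_mul_le_one₀ (by positivity)]
    have := pow_le_pow_left₀ (norm_nonneg _) h1 2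
    linarith
  have hray : ∀ ξ : Euc n, ‖ξ‖ = 1 → ∀ s > 0,
      m (s • ξ) • (s • ξ) = rayProfile c (‖A ξ‖ ^ 2) s • ξ := by
    intro ξ hξ s hs
    have h1 : ‖s • ξ‖ = s := by rw [norm_smul, hξ, mul_one, Real.norm_of_nonneg hs.le]
    have hξ0 : ξ ≠ 0 := norm_ne_zero_iff.mp (by rw [hξ]; norm_num)
    have hAξ : ‖A ξ‖ ≠ 0 := norm_ne_zero_iff.mpr fun h => hξ0 (by simpa using h)
    have h2 : ‖A (s • ξ)‖ ^ 2 = s ^ 2 * ‖A ξ‖ ^ 2 := by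
      rw [map_smul, norm_smul, Real.norm_of_nonneg hs.le, mul_pow]
    rw [smul_smul]
    congr 1
    simp only [m, η]
    rw [h1, h2, rayProfile]
    rcases eq_or_ne (1 - s) 0 with h0 | h0
    · rw [h0]; simp; ring
    · field_simp
  have hdir : ∀ x : Euc n, x ≠ 0 → m x • x = rayProfile c (‖A (‖x‖⁻¹ • x)‖ ^ 2) ‖x‖ •
      (‖x‖⁻¹ • x) := by
    intro x hx
    have := hray (‖x‖⁻¹ • x) (norm_inv_smul_self hx) ‖x‖ (norm_pos_iff.mpr hx)
    rwa [norm_smul_inv_smul hx] at this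
  have hApos : ∀ x : Euc n, x ≠ 0 → 0 < ‖A (‖x‖⁻¹ • x)‖ ^ 2 := fun x hx =>
    hA0 _ (norm_ne_zero_iff.mp (by rw [norm_inv_smul_self hx]; norm_num))
  have hmball : ∀ x : Euc n, x ≠ 0 → ‖x‖ < 1 → 0 < ‖m x • x‖ ∧
      ‖m x • x‖ = rayProfile c (‖A (‖x‖⁻¹ • x)‖ ^ 2) ‖x‖ := by
    intro x hx hx1
    have h1 : rayProfile c (‖A (‖x‖⁻¹ • x)‖ ^ 2) ‖x‖ ∈ Ioi 0 := by
      rw [← image_rayProfile hc0 (hApos x hx) (hcA _ (norm_inv_smul_self hx))]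
      exact mem_image_of_mem _ ⟨norm_pos_iff.mpr hx, hx1⟩
    have h2 : ‖m x • x‖ = rayProfile c (‖A (‖x‖⁻¹ • x)‖ ^ 2) ‖x‖ := by
      rw [hdir x hx, norm_smul, norm_inv_smul_self hx, mul_one, Real.norm_of_nonneg (le_of_lt h1)]
    exact ⟨h2 ▸ h1, h2⟩
  have hms : ContDiffOn ℝ ∞ m (Metric.ball 0 1) := by
    intro x hx
    refine ContDiffAt.contDiffWithinAt ?_
    have hx1 : ‖x‖ < 1 := by simpa using hx
    rcases eq_or_ne x 0 with rfl | hx0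
    · have : m =ᶠ[𝓝 0] fun _ => c := by
        filter_upwards [Metric.ball_mem_nhds (0 : Euc n) (show (0 : ℝ) < 1 / 4 by norm_num)]
          with y hy
        have : ‖y‖ < 1 / 4 := by simpa using hy
        simp only [m, η]
        rw [Real.smoothTransition.zero_of_nonpos (by linarith)]
        ring
      exact contDiffAt_const.congr_of_eventuallyEq this
    · have hn : ContDiffAt ℝ ∞ (fun x : Euc n => ‖x‖) x := contDiffAt_norm ℝ hx0
      have hηs : ContDiffAt ℝ ∞ η x :=
        Real.smoothTransition.contDiffAt.comp x ((contDiffAt_const.mul hn).sub contDiffAt_const)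
      refine ((contDiffAt_const.sub hηs).mul contDiffAt_const).add (hηs.mul (hn.div ?_ ?_))
      · exact (contDiffAt_const.sub hn).mul
          (((contDiff_norm_sq ℝ).comp (A : Euc n →L[ℝ] Euc n).contDiff).contDiffAt)
      · exact mul_ne_zero (by linarith) (hA0 x hx0).ne'
  have hRs : ContDiffOn ℝ ∞ (fun x => m x • x) (Metric.ball 0 1) := hms.smul contDiffOn_id
  refine ⟨fun x => m x • x, ⟨mapsTo_univ _ _, ?_, ?_⟩, ?_, ?_⟩
  · intro x hx y hy hxy
    have hx1 : ‖x‖ < 1 := by simpa using hx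
    have hy1 : ‖y‖ < 1 := by simpa using hy
    simp only at hxy
    rcases eq_or_ne x 0 with rfl | hx0
    · by_contra hne
      have := (hmball y (Ne.symm hne) hy1).1
      rw [← hxy, smul_zero, norm_zero] at this
      exact lt_irrefl _ this
    rcases eq_or_ne y 0 with rfl | hy0
    · have := (hmball x hx0 hx1).1
      rw [hxy, smul_zero, norm_zero] at this
      exact (lt_irrefl _ this).elim
    have hdirs : ‖x‖⁻¹ • x = ‖y‖⁻¹ • y := by
      have key : ∀ z : Euc n, z ≠ 0 → ‖z‖ < 1 → ‖z‖⁻¹ • z = ‖m z • z‖⁻¹ • (m z • z) := by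
        intro z hz hz1
        obtain ⟨h1, h2⟩ := hmball z hz hz1
        rw [h2] at h1
        rw [h2, hdir z hz, smul_smul, inv_mul_cancel₀ h1.ne', one_smul]
      rw [key x hx0 hx1, key y hy0 hy1, hxy]
    have h1 : ‖m x • x‖ = ‖m y • y‖ := by rw [hxy]
    rw [(hmball x hx0 hx1).2, (hmball y hy0 hy1).2, ← hdirs] at h1
    have h2 := (strictMonoOn_rayProfile hc0 (hApos x hx0) (hcA _ (norm_inv_smul_self hx0))).injOn
      ⟨norm_pos_iff.mpr hx0, hx1⟩ ⟨norm_pos_iff.mpr hy0, hy1⟩ h1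
    rw [← norm_smul_inv_smul hx0, hdirs, h2, norm_smul_inv_smul hy0]
  · intro y _
    rcases eq_or_ne y 0 with rfl | hy0
    · exact ⟨0, by simp, by simp⟩
    have hξ := norm_inv_smul_self hy0
    obtain ⟨s, hs, hsy⟩ : ‖y‖ ∈ rayProfile c (‖A (‖y‖⁻¹ • y)‖ ^ 2) '' Ioo 0 1 := by
      rw [image_rayProfile hc0 (hApos y hy0) (hcA _ hξ)]
      exact norm_pos_iff.mpr hy0
    refine ⟨s • (‖y‖⁻¹ • y), ?_, ?_⟩
    · rw [mem_ball_zero_iff, norm_smul, norm_inv_smul_self hy0, mul_one,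
        Real.norm_of_nonneg hs.1.le]
      exact hs.2
    · simp only
      rw [hray _ (norm_inv_smul_self hy0) s hs.1, hsy, norm_smul_inv_smul hy0]
  · rintro ⟨x, hx⟩
    have hx1 : ‖x‖ < 1 := by simpa using hx
    refine isLocalDiffeomorphAt_of_fderiv_injective Metric.isOpen_ball hRs hx fun v hv => ?_
    have hmd : HasFDerivAt m (fderiv ℝ m x) x :=
      ((hms.contDiffAt (Metric.isOpen_ball.mem_nhds hx)).differentiableAt (by simp)).hasFDerivAt
    have hRd := hmd.smul (hasFDerivAt_id x)
    replace hRd : HasFDerivAt (fun x => m x • x) _ x := hRd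
    have hfd : ∀ w, fderiv ℝ (fun x => m x • x) x w = m x • w + fderiv ℝ m x w • x := by
      intro w
      rw [hRd.fderiv]; rfl
    simp only at hv
    rw [hfd] at hv
    rcases eq_or_ne x 0 with rfl | hx0
    · have : m 0 = c := by
        simp only [m, η]
        rw [Real.smoothTransition.zero_of_nonpos (by simp)]
        ring
      rw [this, smul_zero, add_zero] at hv
      exact (smul_eq_zero.mp hv).resolve_left hc0.ne'
    have hmx : m x ≠ 0 := fun h => by
      have := (hmball x hx0 hx1).1
      rw [h, zero_smul, norm_zero] at this
      exact lt_irrefl _ this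
    set ξ := ‖x‖⁻¹ • x with hξdef
    have hξ : ‖ξ‖ = 1 := norm_inv_smul_self hx0
    have hx' := norm_pos_iff.mpr hx0
    obtain ⟨m', hm', hmd'⟩ := exists_hasDerivAt_rayProfile hc0 (hApos x hx0) (hcA _ hξ)
      (s := ‖x‖) ⟨hx', hx1⟩
    -- A vector v in the kernel satisfies m(x) v = -dm(v) x, so it is radial; in the radial
    -- direction the differential is multiplication by the positive derivative m' of the profile.
    have hradial : fderiv ℝ (fun x => m x • x) x ξ = m' • ξ := by
      have hline : HasDerivAt (fun s : ℝ => s • ξ) ξ ‖x‖ := by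
        have := (hasDerivAt_id ‖x‖).smul_const ξ
        rwa [one_smul] at this
      have h1 : HasDerivAt (fun s : ℝ => m (s • ξ) • (s • ξ)) (fderiv ℝ (fun x => m x • x) x ξ)
          ‖x‖ := by
        have h2 : HasFDerivAt (fun x => m x • x) (fderiv ℝ (fun x => m x • x) x) (‖x‖ • ξ) := by
          rw [norm_smul_inv_smul hx0]
          exact hRd.differentiableAt.hasFDerivAt
        exact h2.comp_hasDerivAt ‖x‖ hline
      have h3 : HasDerivAt (fun s : ℝ => m (s • ξ) • (s • ξ)) (m' • ξ) ‖x‖ := by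
        refine (hmd'.smul_const ξ).congr_of_eventuallyEq ?_
        filter_upwards [Ioi_mem_nhds hx'] with s hs using hray ξ hξ s hs
      exact h1.unique h3
    have hvx : v = (-(m x)⁻¹ * fderiv ℝ m x v * ‖x‖) • ξ := by
      have h1 : m x • v = -(fderiv ℝ m x v • x) := eq_neg_of_add_eq_zero_left hv
      rw [mul_smul, hξdef, norm_smul_inv_smul hx0, mul_smul, neg_smul, ← smul_neg, ← h1,
        inv_smul_smul₀ hmx]
    have hzero : (-(m x)⁻¹ * fderiv ℝ m x v * ‖x‖) * m' = 0 := by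
      rw [← hfd, hvx, map_smul, hradial, smul_smul] at hv
      exact (smul_eq_zero.mp hv).resolve_right (norm_ne_zero_iff.mp (by rw [hξ]; norm_num))
    rw [hvx, (mul_eq_zero.mp hzero).resolve_right hm'.ne', zero_smul]
  · intro x hx hx1
    have hx0 : 0 < ‖x‖ := by linarith
    have hxne := norm_pos_iff.mp hx0
    have hAx := hA0 x hxne
    have h1 : 0 < 1 - ‖x‖ := by linarith
    have h2 : η x = 1 := Real.smoothTransition.one_of_one_le (by linarith)
    simp only [m, h2]
    rw [map_smul, map_smul, inv, norm_smul, Real.norm_of_nonneg (by positivity), smul_smul]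
    congr 1
    have : ‖A x‖ ≠ 0 := fun h => by rw [h] at hAx; simp at hAx
    field_simp
    ring

/-- A diffeomorphism of the open unit ball to `ℝⁿ` which, near the unit sphere, is the composition
of a given local diffeomorphism at the origin with two inversions. -/
theorem exists_diffeo_ball (hn : 0 < n) {κ : Euc n → Euc n}
    (hκ : IsLocalDiffeomorphAt (𝓡 n) (𝓡 n) ∞ κ 0) (hκ0 : κ 0 = 0) :
    ∃ D : Euc n → Euc n, BijOn D (Metric.ball 0 1) univ ∧
      IsLocalDiffeomorphOn (𝓡 n) (𝓡 n) ∞ D (Metric.ball 0 1) ∧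
      ∃ ρ < 1, ∀ x, ρ < ‖x‖ → ‖x‖ < 1 → D x = inv (κ (((1 - ‖x‖) / ‖x‖) • x)) := by
  let A : Euc n ≃L[ℝ] Euc n := hκ.mfderivToContinuousLinearEquiv (by simp)
  have hA : HasFDerivAt κ (A : Euc n →L[ℝ] Euc n) 0 := by
    have h1 : DifferentiableAt ℝ κ 0 := (hκ.mdifferentiableAt (by simp)).differentiableAt
    have h2 : fderiv ℝ κ 0 = A := by
      rw [← mfderiv_eq_fderiv]; rfl
    rw [← h2]
    exact h1.hasFDerivAt
  obtain ⟨Φ, hΦ0, hΦ⟩ := hκ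
  have hκs : ContDiffOn ℝ ∞ κ Φ.source :=
    (Φ.contMDiffOn_toFun.congr hΦ).contDiffOn
  set U : Set (Euc n) := A.symm ⁻¹' Φ.source with hUdef
  -- Dividing by the linear part A leaves a germ tangent to the identity.
  obtain ⟨K, hK, hKd, hKg, r, hr, hKr⟩ := exists_extension_of_germ hn (g := κ ∘ A.symm) (U := U)
    (Φ.open_source.preimage A.symm.continuous) (by simpa [U] using hΦ0)
    (hκs.comp A.symm.contDiff.contDiffOn fun _ h => h) (by simp [hκ0]) (by
      have h1 : HasFDerivAt κ (A : Euc n →L[ℝ] Euc n) (A.symm 0) := by simpa using hA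
      have h2 := h1.comp (0 : Euc n) A.symm.hasFDerivAt
      simpa using h2)
  obtain ⟨R, hR, hRd, hRs⟩ := exists_radial_diffeo A
  have hK0 : K 0 = 0 := by rw [hKg.self_of_nhds]; simp [hκ0]
  have hH := isLocalDiffeomorph_inv_conj hK.1 hKd hK0 hr hKr
  have hHb : Function.Bijective (inv ∘ K ∘ inv) :=
    inv_involutive.bijective.comp (hK.comp inv_involutive.bijective)
  have hKA : ∀ᶠ y in 𝓝 (0 : Euc n), K (A y) = κ y := by
    have : Tendsto A (𝓝 0) (𝓝 0) := by simpa using A.continuous.tendsto 0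
    filter_upwards [this.eventually hKg] with y hy
    rw [hy]; simp
  obtain ⟨δ, hδ, hδK⟩ := Metric.eventually_nhds_iff_ball.mp hKA
  -- Put w = ((1 - |x|)/|x|) x. Near the unit sphere A(R x) = inv(A w), the two inner inversions
  -- cancel, and inv(K(A w)) = inv(κ w) remains. Since |w| = 1 - |x|, the bound 1 - δ places w where
  -- K ∘ A = κ.
  refine ⟨(inv ∘ K ∘ inv) ∘ A ∘ R, ?_, ?_, max (1 / 2) (1 - δ),
    max_lt (by norm_num) (by linarith), ?_⟩
  · exact (bijOn_univ.mpr (hHb.comp A.bijective)).comp hR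
  · rintro ⟨x, hx⟩
    have hAd : IsLocalDiffeomorphAt (𝓡 n) (𝓡 n) ∞ A (R x) :=
      isLocalDiffeomorphAt_of_hasFDerivAt isOpen_univ A.contDiff.contDiffOn (mem_univ _) A
        A.hasFDerivAt
    exact ((hRd ⟨x, hx⟩).comp _ _ hAd).comp _ _ (hH _)
  · intro x hx hx1
    have h1 : 1 / 2 < ‖x‖ := (le_max_left _ _).trans_lt hx
    have h2 : 1 - δ < ‖x‖ := (le_max_right _ _).trans_lt hx
    simp only [Function.comp_apply]
    rw [hRs x h1.le hx1, inv_involutive, hδK]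
    rw [mem_ball_zero_iff, norm_smul, Real.norm_of_nonneg (div_nonneg (by linarith) (by linarith)),
      div_mul_cancel₀ _ (by linarith)]
    linarith

end

/-! ### Connected sum with a sphere -/

section

open Filter Topology

variable {n : ℕ}

theorem coe_orthogonalProjectionOnto_congr {E : Type*} [NormedAddCommGroup E]
    [InnerProductSpace ℝ E] {K K' : Submodule ℝ E} [K.HasOrthogonalProjection]
    [K'.HasOrthogonalProjection] (h : K = K') (x : E) :
    (K.orthogonalProjectionOnto x : E) = K'.orthogonalProjectionOnto x := by
  subst h
  rfl

/-- The stereographic projections from opposite points of the sphere differ by an inversion and a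
similarity. -/
theorem exists_stereographic'_eq {E : Type*} [NormedAddCommGroup E] [InnerProductSpace ℝ E]
    [Fact (Module.finrank ℝ E = n + 1)] (v : Metric.sphere (0 : E) 1) :
    ∃ O : Euc n ≃ₗᵢ[ℝ] Euc n, ∀ x, x ≠ v → x ≠ -v →
      stereographic' n v x = (4 : ℝ) • O (inv (stereographic' n (-v) x)) := by
  let U := (OrthonormalBasis.fromOrthogonalSpanSingleton (𝕜 := ℝ) n
    (ne_zero_of_mem_unit_sphere v)).repr
  let U' := (OrthonormalBasis.fromOrthogonalSpanSingleton (𝕜 := ℝ) n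
    (ne_zero_of_mem_unit_sphere (-v))).repr
  have hspan : (Submodule.span ℝ {((-v : Metric.sphere (0 : E) 1) : E)})ᗮ =
      (Submodule.span ℝ {(v : E)})ᗮ := by
    rw [coe_neg_sphere, ← Set.neg_singleton, Submodule.span_neg]
  let T := LinearIsometryEquiv.ofEq _ _ hspan
  refine ⟨U'.symm.trans (T.trans U), fun x hxv hxv' => ?_⟩
  set a : ℝ := inner ℝ (v : E) x with ha
  have hv1 : ‖(v : E)‖ = 1 := norm_eq_of_mem_sphere v
  have hx1 : ‖(x : E)‖ = 1 := norm_eq_of_mem_sphere x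
  set w := (Submodule.span ℝ {(v : E)})ᗮ.orthogonalProjectionOnto (x : E) with hw
  set w' := (Submodule.span ℝ {((-v : Metric.sphere (0 : E) 1) : E)})ᗮ.orthogonalProjectionOnto
    (x : E) with hw'
  have hTw : T w' = w := Subtype.ext (coe_orthogonalProjectionOnto_congr hspan (x : E))
  have h1 : stereographic' n v x = U ((2 / (1 - a)) • w) := rfl
  have h2 : stereographic' n (-v) x = U' ((2 / (1 + a)) • w') := by
    have h3 : stereographic' n (-v) x =
        U' ((2 / (1 - inner ℝ ((-v : Metric.sphere (0 : E) 1) : E) (x : E))) • w') := rfl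
    have h4 : inner ℝ ((-v : Metric.sphere (0 : E) 1) : E) (x : E) = -a := by
      rw [coe_neg_sphere, inner_neg_left]
    rw [h3, h4, sub_neg_eq_add]
  -- The two projections are 2/(1 - a) and 2/(1 + a) times the same orthogonal component, whose
  -- squared norm is (1 - a)(1 + a). The product of their norms is therefore 4, the factor in the
  -- statement.
  have hnorm : ‖w'‖ ^ 2 = 1 - a ^ 2 := by
    have h3 := Submodule.norm_sq_eq_add_norm_sq_projection (x : E) (Submodule.span ℝ {(v : E)})
    have h4 : ‖(Submodule.span ℝ {(v : E)}).orthogonalProjectionOnto (x : E)‖ = |a| := by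
      change ‖((Submodule.span ℝ {(v : E)}).orthogonalProjectionOnto (x : E) : E)‖ = |a|
      rw [← Submodule.starProjection_apply,
        Submodule.starProjection_unit_singleton ℝ hv1, norm_smul, hv1, mul_one, Real.norm_eq_abs]
    rw [h4, sq_abs, hx1] at h3
    have h5 : ‖w'‖ = ‖w‖ := by rw [← hTw, T.norm_map]
    rw [h5]
    linarith
  have ha1 : a ≠ 1 := fun h => hxv (Subtype.ext
    ((inner_eq_one_iff_of_norm_eq_one hv1 hx1).mp h)).symm
  have ha2 : a ≠ -1 := fun h => hxv' (Subtype.ext (by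
    have h3 : inner ℝ (-(v : E)) (x : E) = (1 : ℝ) := by rw [inner_neg_left, ← ha, h, neg_neg]
    rw [coe_neg_sphere]
    exact ((inner_eq_one_iff_of_norm_eq_one (by rw [norm_neg, hv1]) hx1).mp h3).symm))
  have hs : 1 - a ≠ 0 := sub_ne_zero.mpr ha1.symm
  have hp : 1 + a ≠ 0 := fun h => ha2 (by linarith)
  rw [h1, h2, inv, U'.norm_map, norm_smul, mul_pow, Real.norm_eq_abs, sq_abs, hnorm]
  simp only [map_smul, LinearIsometryEquiv.trans_apply, LinearIsometryEquiv.symm_apply_apply]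
  rw [hTw, smul_smul, smul_smul]
  congr 1
  have hq : 1 - a ^ 2 ≠ 0 := by
    rw [show 1 - a ^ 2 = (1 - a) * (1 + a) by ring]; exact mul_ne_zero hs hp
  field_simp
  ring

section

variable {M₂ : Type*} [TopologicalSpace M₂] [ChartedSpace (Euc n) M₂]

/-- The complement of the centre of a disc in a sphere is diffeomorphic to `ℝⁿ`, in such a way that
near infinity the disc is a local diffeomorphism at the origin composed with the inversion. -/
theorem exists_diffeo_compl_centre
    (Φ : M₂ ≃ₘ^∞⟮𝓡 n, 𝓡 n⟯ (Metric.sphere (0 : EuclideanSpace ℝ (Fin (n + 1))) 1))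
    {i : Euc n → M₂} (hi : IsDisc i) :
    ∃ (e : Euc n → M₂) (κ : Euc n → Euc n), BijOn e univ {i 0}ᶜ ∧
      IsLocalDiffeomorph (𝓡 n) (𝓡 n) ∞ e ∧ IsLocalDiffeomorphAt (𝓡 n) (𝓡 n) ∞ κ 0 ∧ κ 0 = 0 ∧
      ∀ᶠ y in 𝓝 0, y ≠ 0 → e (inv (κ y)) = i y := by
  have : Fact (Module.finrank ℝ (EuclideanSpace ℝ (Fin (n + 1))) = n + 1) :=
    ⟨finrank_euclideanSpace_fin⟩
  set p := Φ (i 0) with hp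
  obtain ⟨O, hO⟩ := exists_stereographic'_eq (n := n) p
  set σ := stereographic' n p with hσ
  set τ := stereographic' n (-p) with hτ
  have hmax : ∀ q : Metric.sphere (0 : EuclideanSpace ℝ (Fin (n + 1))) 1,
      stereographic' n q ∈ IsManifold.maximalAtlas (𝓡 n) ∞
        (Metric.sphere (0 : EuclideanSpace ℝ (Fin (n + 1))) 1) := fun q =>
    IsManifold.subset_maximalAtlas ⟨q, rfl⟩
  have hpp : p ≠ -p := ne_neg_of_mem_unit_sphere ℝ p
  have hτp : τ p = 0 := by
    have h1 : stereographic (norm_eq_of_mem_sphere (-p)) p = 0 := stereographic_neg_apply p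
    change (OrthonormalBasis.fromOrthogonalSpanSingleton (𝕜 := ℝ) n
      (ne_zero_of_mem_unit_sphere (-p))).repr (stereographic (norm_eq_of_mem_sphere (-p)) p) = 0
    rw [h1, map_zero]
  let L : Euc n ≃L[ℝ] Euc n :=
    O.toContinuousLinearEquiv.trans (ContinuousLinearEquiv.smulLeft (Units.mk0 (4 : ℝ) (by simp)))
  have hL : ∀ y, L y = (4 : ℝ) • O y := fun y => rfl
  have hσt : ∀ y, y ∈ σ.target := fun y => by simp [σ]
  have hσs : σ.source = {p}ᶜ := stereographic'_source p
  -- The chart from the centre p parametrises its complement, and κ is the disc read in the chart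
  -- from -p, which sends p to 0. The similarity `L` absorbs the discrepancy between the charts,
  -- leaving the pure inversion.
  refine ⟨fun y => Φ.symm (σ.symm (L y)), fun y => τ (Φ (i y)), ?_, fun y => ?_, ?_, hτp, ?_⟩
  · refine ⟨fun y _ h => ?_, fun y _ z _ h => ?_, fun x hx => ?_⟩
    · have h1 : σ.symm (L y) = p := by
        rw [hp, ← show Φ.symm (σ.symm (L y)) = i 0 from h, Φ.apply_symm_apply]
      have h2 := σ.map_target (hσt (L y))
      rw [h1, hσs] at h2
      exact h2 rfl
    · have h1 := Φ.symm.injective h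
      exact L.injective (σ.symm.injOn (hσt _) (hσt _) h1)
    · have h1 : Φ x ∈ σ.source := by
        rw [hσs]
        exact fun h => hx (Φ.injective h)
      refine ⟨L.symm (σ (Φ x)), mem_univ _, ?_⟩
      simp only [ContinuousLinearEquiv.apply_symm_apply]
      rw [σ.left_inv h1, Φ.symm_apply_apply]
  · have h1 : IsLocalDiffeomorphAt (𝓡 n) (𝓡 n) ∞ L y :=
      isLocalDiffeomorphAt_of_hasFDerivAt isOpen_univ L.contDiff.contDiffOn (mem_univ _) L
        L.hasFDerivAt
    exact (h1.comp _ _ (isLocalDiffeomorphAt_symm_of_mem_maximalAtlas (hmax p) (hσt _))).comp _ _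
      (Φ.symm.isLocalDiffeomorph _)
  · refine ((hi.1 0).comp _ _ (Φ.isLocalDiffeomorph _)).comp _ _
      (isLocalDiffeomorphAt_of_mem_maximalAtlas (hmax (-p)) ?_)
    rw [stereographic'_source]
    exact hpp
  · have hcont : ContinuousAt (fun y => Φ (i y)) 0 :=
      (Φ.continuous.comp hi.1.contMDiff.continuous).continuousAt
    filter_upwards [hcont.eventually_ne hpp] with y hy hy0
    have h1 : Φ (i y) ≠ p := fun h => hy0 (hi.2 (Φ.injective h))
    rw [hL, ← hO _ h1 hy, σ.left_inv (by rw [hσs]; exact h1), Φ.symm_apply_apply]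

end

variable {M₁ M₂ M : Type*} [TopologicalSpace M₁] [ChartedSpace (Euc n) M₁] [TopologicalSpace M₂]
  [ChartedSpace (Euc n) M₂] [TopologicalSpace M] [ChartedSpace (Euc n) M]

/-- A disc in a sphere is the complement of another disc, the two being glued along the collar as
in a connected sum. -/
theorem exists_complementary_ball (hn : 0 < n)
    (Φ : M₂ ≃ₘ^∞⟮𝓡 n, 𝓡 n⟯ (Metric.sphere (0 : EuclideanSpace ℝ (Fin (n + 1))) 1))
    {i : Euc n → M₂} (hi : IsDisc i) :
    ∃ c : Euc n → M₂, BijOn c (Metric.ball 0 1) {i 0}ᶜ ∧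
      IsLocalDiffeomorphOn (𝓡 n) (𝓡 n) ∞ c (Metric.ball 0 1) ∧
      ∃ ρ < 1, 0 < ρ ∧ ∀ x, ρ < ‖x‖ → ‖x‖ < 1 → c x = i (((1 - ‖x‖) / ‖x‖) • x) := by
  obtain ⟨e, κ, he, hed, hκ, hκ0, heκ⟩ := exists_diffeo_compl_centre Φ hi
  obtain ⟨D, hD, hDd, ρ, hρ, hDρ⟩ := exists_diffeo_ball hn hκ hκ0
  obtain ⟨δ, hδ, hδe⟩ := Metric.eventually_nhds_iff_ball.mp heκ
  refine ⟨e ∘ D, he.comp hD, fun x => (hDd x).comp _ _ (hed _), max (max ρ (1 / 2)) (1 - δ),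
    max_lt (max_lt hρ (by norm_num)) (by linarith),
    lt_max_of_lt_left (lt_max_of_lt_right (by norm_num)), fun x hx hx1 => ?_⟩
  have h1 : ρ < ‖x‖ := ((le_max_left _ _).trans (le_max_left _ _)).trans_lt hx
  have h2 : 1 / 2 < ‖x‖ := ((le_max_right _ _).trans (le_max_left _ _)).trans_lt hx
  have h3 : 1 - δ < ‖x‖ := (le_max_right _ _).trans_lt hx
  have h4 : 0 < (1 - ‖x‖) / ‖x‖ := div_pos (by linarith) (by linarith)
  rw [Function.comp_apply, hDρ x h1 hx1]
  refine hδe _ ?_ (smul_ne_zero h4.ne' (norm_pos_iff.mp (by linarith)))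
  rw [mem_ball_zero_iff, norm_smul, Real.norm_of_nonneg h4.le, div_mul_cancel₀ _ (by linarith)]
  linarith

/-- The connected sum with a sphere does not change a manifold. -/
theorem IsConnectedSum.nonempty_diffeomorph [T2Space M₁] (hn : 0 < n)
    (h : IsConnectedSum n M₁ M₂ M)
    (Φ : M₂ ≃ₘ^∞⟮𝓡 n, 𝓡 n⟯ (Metric.sphere (0 : EuclideanSpace ℝ (Fin (n + 1))) 1)) :
    Nonempty (M₁ ≃ₘ^∞⟮𝓡 n, 𝓡 n⟯ M) := by
  classical
  obtain ⟨i₁, i₂, f₁, f₂, hi₁, hi₂, hf₁, hf₁', hf₂, hf₂', hun, hglue⟩ := h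
  obtain ⟨c, hc, hcd, ρ, hρ1, hρ0, hcρ⟩ := exists_complementary_ball hn Φ hi₂
  -- The diffeomorphism is f₁ outside the open disc and f₂ ∘ c inside it, with c the complementary
  -- ball.
  have hex : ∀ y : M₁, ∃ z : M, (∀ x ∈ Metric.ball (0 : Euc n) 1, i₁ x = y → z = f₂ (c x)) ∧
      (y ∉ i₁ '' Metric.ball 0 1 → z = f₁ y) := by
    intro y
    by_cases hy : y ∈ i₁ '' Metric.ball 0 1
    · obtain ⟨x, hx, rfl⟩ := hy
      refine ⟨f₂ (c x), fun x' _ h => by rw [hi₁.2 h], fun h => (h ⟨x, hx, rfl⟩).elim⟩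
    · exact ⟨f₁ y, fun x hx h => (hy ⟨x, hx, h⟩).elim, fun _ => rfl⟩
  choose Ψ hΨ₂ hΨ₁ using hex
  replace hΨ₂ : ∀ x ∈ Metric.ball (0 : Euc n) 1, Ψ (i₁ x) = f₂ (c x) :=
    fun x hx => hΨ₂ _ x hx rfl
  have hne : ∀ x : Euc n, x ≠ 0 → i₁ x ∈ ({i₁ 0}ᶜ : Set M₁) := fun x hx h => hx (hi₁.2 h)
  have hne₂ : ∀ x : Euc n, x ≠ 0 → i₂ x ∈ ({i₂ 0}ᶜ : Set M₂) := fun x hx h => hx (hi₂.2 h)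
  have hflip : ∀ x : Euc n, x ≠ 0 → ‖x‖ < 1 →
      f₁ (i₁ x) = f₂ (i₂ (((1 - ‖x‖) / ‖x‖) • x)) := by
    intro x hx hx1
    have hx0 : 0 < ‖x‖ := norm_pos_iff.mpr hx
    have h0 : (1 - ‖x‖) / ‖x‖ ≠ 0 := (div_pos (by linarith) hx0).ne'
    refine (hglue _ (hne x hx) _ (hne₂ _ (smul_ne_zero h0 hx))).mpr
      ⟨‖x‖⁻¹ • x, norm_inv_smul_self hx, ‖x‖, ⟨hx0, hx1⟩, ?_, ?_⟩
    · rw [norm_smul_inv_smul hx]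
    · rw [smul_smul, div_eq_mul_inv]
  -- On the shell ρ < |x| < 1 the prescribed form of c cancels against the gluing relation, so both
  -- definitions agree there; this gives smoothness across the boundary of the disc.
  have hΨ : ∀ y ∉ i₁ '' Metric.closedBall 0 ρ, Ψ y = f₁ y := by
    intro y hy
    by_cases hy1 : y ∈ i₁ '' Metric.ball 0 1
    · obtain ⟨x, hx, rfl⟩ := hy1
      have hx1 : ‖x‖ < 1 := by simpa using hx
      have hxρ : ρ < ‖x‖ := by
        by_contra hcon
        exact hy ⟨x, by simpa using hcon, rfl⟩
      rw [hΨ₂ x hx, hcρ x hxρ hx1, hflip x (norm_pos_iff.mp (hρ0.trans hxρ)) hx1]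
    · exact hΨ₁ y hy1
  have hcl : IsClosed (i₁ '' Metric.closedBall 0 ρ) :=
    ((isCompact_closedBall _ _).image hi₁.continuous).isClosed
  have hcne : ∀ x ∈ Metric.ball (0 : Euc n) 1, c x ∈ ({i₂ 0}ᶜ : Set M₂) := hc.mapsTo
  have hd : IsLocalDiffeomorph (𝓡 n) (𝓡 n) ∞ Ψ := by
    intro y
    by_cases hy : y ∈ i₁ '' Metric.ball 0 1
    · obtain ⟨x, hx, rfl⟩ := hy
      refine isLocalDiffeomorphAt_of_comp_right
        ((hcd ⟨x, hx⟩).comp _ _ (hf₂ ⟨c x, hcne x hx⟩)) (hi₁.1 x) ?_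
      filter_upwards [Metric.isOpen_ball.mem_nhds hx] with z hz using hΨ₂ z hz
    · have hy0 : y ∈ ({i₁ 0}ᶜ : Set M₁) := fun h => hy ⟨0, by simp, h.symm⟩
      refine isLocalDiffeomorphAt_congr (hf₁ ⟨y, hy0⟩) ?_
      have hyρ : y ∉ i₁ '' Metric.closedBall 0 ρ := fun h =>
        hy (image_mono (Metric.closedBall_subset_ball hρ1) h)
      filter_upwards [hcl.isOpen_compl.mem_nhds hyρ] with z hz using hΨ z hz
  -- Only points of the open discs are glued, so a point of M₁ outside the open disc never shares
  -- its image with the second summand.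
  have hmix : ∀ x ∈ Metric.ball (0 : Euc n) 1, ∀ y ∉ i₁ '' Metric.ball 0 1,
      f₂ (c x) ≠ f₁ y := by
    intro x hx y hy h
    have hy0 : y ∈ ({i₁ 0}ᶜ : Set M₁) := fun h => hy ⟨0, by simp, h.symm⟩
    obtain ⟨ξ, hξ, t, ht, rfl, -⟩ := (hglue y hy0 _ (hcne x hx)).mp h.symm
    refine hy ⟨t • ξ, ?_, rfl⟩
    rw [mem_ball_zero_iff, norm_smul, hξ, mul_one, Real.norm_of_nonneg ht.1.le]
    exact ht.2
  have hinj : Function.Injective Ψ := by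
    intro y z hyz
    by_cases hy : y ∈ i₁ '' Metric.ball 0 1 <;> by_cases hz : z ∈ i₁ '' Metric.ball 0 1
    · obtain ⟨x, hx, rfl⟩ := hy
      obtain ⟨w, hw, rfl⟩ := hz
      rw [hΨ₂ x hx, hΨ₂ w hw] at hyz
      rw [hc.injOn hx hw (hf₂' (hcne x hx) (hcne w hw) hyz)]
    · obtain ⟨x, hx, rfl⟩ := hy
      rw [hΨ₂ x hx, hΨ₁ z hz] at hyz
      exact (hmix x hx z hz hyz).elim
    · obtain ⟨w, hw, rfl⟩ := hz
      rw [hΨ₂ w hw, hΨ₁ y hy] at hyz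
      exact (hmix w hw y hy hyz.symm).elim
    · rw [hΨ₁ y hy, hΨ₁ z hz] at hyz
      exact hf₁' (fun h => hy ⟨0, by simp, h.symm⟩) (fun h => hz ⟨0, by simp, h.symm⟩) hyz
  have hrange₂ : ∀ w ∈ ({i₂ 0}ᶜ : Set M₂), ∃ y, Ψ y = f₂ w := by
    intro w hw
    obtain ⟨x, hx, rfl⟩ := hc.surjOn hw
    exact ⟨i₁ x, hΨ₂ x hx⟩
  have hsurj : Function.Surjective Ψ := by
    intro z
    have hz : z ∈ f₁ '' {i₁ 0}ᶜ ∪ f₂ '' {i₂ 0}ᶜ := hun ▸ mem_univ z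
    rcases hz with ⟨y, hy, rfl⟩ | ⟨w, hw, rfl⟩
    · by_cases hy1 : y ∈ i₁ '' Metric.ball 0 1
      · obtain ⟨x, hx, rfl⟩ := hy1
        have hx1 : ‖x‖ < 1 := by simpa using hx
        have hx0 : x ≠ 0 := fun h => hy (by rw [h]; rfl)
        rw [hflip x hx0 hx1]
        exact hrange₂ _ (hne₂ _ (smul_ne_zero
          (div_pos (by linarith) (norm_pos_iff.mpr hx0)).ne' hx0))
      · exact ⟨y, hΨ₁ y hy1⟩
    · exact hrange₂ w hw
  exact ⟨hd.diffeomorphOfBijective ⟨hinj, hsurj⟩⟩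

end

end NeckSurgery

/-! ### Surgery is reverse connected sum -/

theorem mainTheorem9 (n : ℕ) (hn : 2 ≤ n) :
    ∃ (ε₀ : ℝ) (k₀ : ℕ), 0 < ε₀ ∧ 1 ≤ k₀ ∧
      ∀ (Λ ε : ℝ) (k : ℕ), 10 ≤ Λ → 0 < ε → ε ≤ ε₀ → k₀ ≤ k →
      ∀ (m : ℕ) (M : Type*) [TopologicalSpace M] [T2Space M] [CompactSpace M] [ConnectedSpace M]
        [ChartedSpace (NeckSurgery.Euc n) M] [IsManifold (𝓡 n) ∞ M]
        (F : M → NeckSurgery.Euc (n + m)) (N : NeckSurgery.Euc n → ℝ → M),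
      NeckSurgery.IsSmoothImmersion (n := n) F →
      NeckSurgery.IsNormalSubmanifoldNeck F N (-(4 * Λ)) (4 * Λ) ε k →
      ∀ (τ B : ℝ), 0 < τ → τ < 1 → 10 * Λ < B →
      ∀ (M' : Type*) [TopologicalSpace M'] [T2Space M'] [CompactSpace M']
        [ChartedSpace (NeckSurgery.Euc n) M'] [IsManifold (𝓡 n) ∞ M']
        (F' : M' → NeckSurgery.Euc (n + m)),
      NeckSurgery.IsSmoothImmersion (n := n) F' →
      NeckSurgery.IsStandardSurgery F N Λ τ B F' →
      (ConnectedSpace M' → NeckSurgery.IsSelfConnectedSum n M' M) ∧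
      (¬ ConnectedSpace M' → ∃ M₁ M₂ : TopologicalSpace.Opens M',
        ConnectedSpace M₁ ∧ ConnectedSpace M₂ ∧ IsCompl M₁ M₂) ∧
      (∀ M₁ M₂ : TopologicalSpace.Opens M',
        ConnectedSpace M₁ → ConnectedSpace M₂ → IsCompl M₁ M₂ →
        NeckSurgery.IsConnectedSum n M₁ M₂ M ∧
        (Nonempty (M₂ ≃ₘ^∞⟮𝓡 n, 𝓡 n⟯
            (Metric.sphere (0 : EuclideanSpace ℝ (Fin (n + 1))) 1)) →
          Nonempty (M₁ ≃ₘ^∞⟮𝓡 n, 𝓡 n⟯ M))) := by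
  -- Any positive values would serve: the argument rests on the neck as an embedded cylinder and on
  -- how the balls are attached.
  refine ⟨1, 1, one_pos, le_rfl, ?_⟩
  intro Λ ε k hΛ _ _ _ m M _ _ _ _ _ _ F N _ hN τ B _ _ _ M' _ _ _ _ _ F' _ hS
  have hn0 : 0 < n := by omega
  obtain ⟨i₁, i₂, f, h⟩ := hS.exists_isSelfGluing (by linarith) hN.topological
  refine ⟨fun _ => h.isSelfConnectedSum, h.exists_two_components hn0, fun M₁ M₂ h₁ h₂ hM => ?_⟩
  have hsum := h.isConnectedSum_of_isCompl hn0 h₁.toNonempty h₂.toNonempty hM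
  exact ⟨hsum, fun ⟨Φ⟩ => hsum.nonempty_diffeomorph hn0 Φ⟩
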